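/- Let $U\subset\mathbb{R}^2$ be a domain (a nonempty connected open set) and let $W$ be a planar $4$-web on $U$, given by four smooth $1$-forms, any two of which are linearly independent at every point of $U$. Let $\omega_1,\dots,\omega_4$ be any normalization of $W$, that is, the given forms multiplied by nonvanishing smooth functions such that $$\omega_1+\omega_2+\omega_3=0,\qquad a\,\omega_1+\omega_2+\omega_4=0$$ for a function $a$ (the basic invariant of $W$; $a\ne 0,1$ everywhere). The rank of $W$ on an open set $V\subset U$ is the dimension of the real vector space of quadruples $(\lambda_1,\dots,\lambda_4)$ of smooth functions on $V$ with $\sum_i\lambda_i\omega_i=0$ and $d(\lambda_i\omega_i)=0$ for $i=1,\dots,4$. The rank of $W$ near a point $p$ is the common value of its ranks on all sufficiently small discs (or squares) centred at $p$. Let $\gamma$ be the unique $1$-form with $d\omega_i=\omega_i\wedge\gamma$ for $i=1,2,3$ (the connection form of the Chern connection of the $3$-subweb $[1,2,3]$), let $K$ be the curvature function of $[1,2,3]$, defined by $d\gamma=K\,\omega_1\wedge\omega_2$, let $\partial_1,\partial_2$ be the frame dual to $\omega_1,\omega_2$, and let $\partial_3=\partial_2-\partial_1$, $\partial_4=a\,\partial_2-\partial_1$.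 The covariant derivative of a function $u$ of weight $w$ along $\partial_i$ is $\delta_i u=\partial_i(u)-w\,\gamma(\partial_i)\,u$, a function of weight $w+1$; here $a$ has weight $0$ and $K$ has weight $2$. Write $a_i=\delta_i a$, $K_i=\delta_i K$, $a_{ij}=\delta_i\delta_j a$ (one has $a_{12}=a_{21}$), and let $a_{112}$, $a_{122}$ be the symmetrized third covariant derivatives $$a_{112}=\tfrac13(\delta_1\delta_1\delta_2+\delta_1\delta_2\delta_1+\delta_2\delta_1\delta_1)a,\qquad a_{122}=\tfrac13(\delta_1\delta_2\delta_2+\delta_2\delta_1\delta_2+\delta_2\delta_2\delta_1)a .$$ Consider the following three formulas on $U$: $$K=\frac{-a_{11}+aa_{22}+2(1-a)a_{12}}{4a(1-a)}+\frac{(1-2a)a_1^2+a^2a_2^2-2(1-a)^2a_1a_2}{4(1-a)^2a^2},$$ $$K_3=\frac{(4-a)a_1-(11-20a+12a^2)a_2}{3(1-a)a}K+\frac{a_{122}-a_{112}}{a}+\frac{a_4a_{22}}{a^2}+\frac{(2a-1)a_4a_{12}}{(1-a)a^2}+\frac{2a_2^2(1-a)a_1+a_2^2a_4}{(1-a)a^2},$$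 $$K_4=\frac{aa_4-(1-a)a_1-2aa_3}{(1-a)a}K.$$ Then the web $W$ has maximum rank three near every point of $U$ if and only if the three formulas hold on $U$. Moreover, if $W$ has rank three on $U$, then the three formulas hold on $U$; and if $U$ is simply connected, then $W$ has rank three on $U$ if and only if the three formulas hold on $U$. -/

import Mathlib

open TopologicalSpace Topology
open scoped ContDiff

noncomputable section

/-- The plane `ℝ²` with coordinates `(x, y)`. -/
abbrev Plane : Type := ℝ × ℝ

/-- Differential `1`-forms on the plane (smoothness is imposed separately, on a domain). -/
abbrev OneForm : Type := Plane → Plane →L[ℝ] ℝ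

/-- The exterior derivative of a `1`-form (Mathlib's `extDeriv`). -/
def extD (α : OneForm) (p : Plane) : Plane [⋀^Fin 2]→L[ℝ] ℝ :=
  extDeriv (fun q => ContinuousAlternatingMap.ofSubsingletonLIE (0 : Fin 1) (α q)) p

/-- `dα (v, w) = (D_v α) w - (D_w α) v`. -/
theorem extD_apply {α : OneForm} {p : Plane} (hα : DifferentiableAt ℝ α p) (v w : Plane) :
    extD α p ![v, w] = fderiv ℝ α p v w - fderiv ℝ α p w v := by
  set L := (ContinuousAlternatingMap.ofSubsingletonLIE (0 : Fin 1) :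
    (Plane →L[ℝ] ℝ) ≃ₗᵢ[ℝ] _) with hL
  have hd : DifferentiableAt ℝ (fun q => L (α q)) p :=
    L.toContinuousLinearEquiv.differentiable.differentiableAt.comp p hα
  have key : ∀ c z : Plane, fderiv ℝ (fun q => α q c) p z = fderiv ℝ α p z c := fun c z => by
    rw [fderiv_clm_apply hα (differentiableAt_const c)]
    simp
  have h : ∀ (q : Plane) (m : Fin 1 → Plane), L (α q) m = α q (m 0) := fun _ _ => rfl
  rw [extD, extDeriv_apply hd, Fin.sum_univ_two]
  simp [h, key, sub_eq_add_neg, Fin.removeNth]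

/-- The exterior derivative is additive on differentiable forms. -/
theorem extD_add {α β : OneForm} {p : Plane} (hα : DifferentiableAt ℝ α p)
    (hβ : DifferentiableAt ℝ β p) :
    extD (fun q => α q + β q) p = extD α p + extD β p := by
  set L := (ContinuousAlternatingMap.ofSubsingletonLIE (0 : Fin 1) :
    (Plane →L[ℝ] ℝ) ≃ₗᵢ[ℝ] _) with hL
  have h : ∀ {γ : OneForm}, DifferentiableAt ℝ γ p →
      DifferentiableAt ℝ (fun q => L (γ q)) p := fun hγ =>
    L.toContinuousLinearEquiv.differentiable.differentiableAt.comp p hγ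
  simp only [extD, map_add]
  exact extDeriv_fun_add (h hα) (h hβ)

/-- The exterior derivative commutes with constant multiples. -/
theorem extD_const_smul (c : ℝ) (α : OneForm) (p : Plane) :
    extD (fun q => c • α q) p = c • extD α p := by
  simp only [extD, map_smul]
  exact extDeriv_fun_smul c _

/-- A planar `d`-web on an open set `U ⊆ ℝ²`, given by `d` smooth `1`-forms any two of which are
linearly independent at every point of `U`.  The leaves of the `i`-th foliation are the integral
curves of `form i = 0`. -/
structure PlanarWeb (d : ℕ) (U : Opens Plane) where
  form : Fin d → OneForm
  smooth : ∀ i, ContDiffOn ℝ ∞ (form i) U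
  transversal : ∀ i j, i ≠ j → ∀ p ∈ U, LinearIndependent ℝ ![form i p, form j p]

namespace PlanarWeb

variable {d : ℕ} {U : Opens Plane}

/-- The restriction of a web to a smaller open set. -/
def restrict (W : PlanarWeb d U) (V : Opens Plane) : PlanarWeb d (U ⊓ V) where
  form := W.form
  smooth i := (W.smooth i).mono fun _ hp => hp.1
  transversal i j hij p hp := W.transversal i j hij p hp.1

theorem differentiableAt_smul_form (W : PlanarWeb d U) {f : Plane → ℝ}
    (hf : ContDiffOn ℝ ∞ f U) (i : Fin d) {p : Plane} (hp : p ∈ U) :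
    DifferentiableAt ℝ (fun q => f q • W.form i q) p :=
  ((hf.smul (W.smooth i)).contDiffAt (U.isOpen.mem_nhds hp)).differentiableAt (by simp)

/-- The solution space of the abelian equation of the web: smooth functions `lam 0, …, lam (d-1)`
on `U` with `∑ i, lam i • form i = 0` and every `lam i • form i` closed.  Functions on `U` are
represented by functions on the plane that vanish outside `U`. -/
def abelianRelations (W : PlanarWeb d U) : Submodule ℝ (Fin d → Plane → ℝ) where
  carrier := { lam |
    (∀ i, ContDiffOn ℝ ∞ (lam i) U) ∧
    (∀ i, ∀ p ∉ U, lam i p = 0) ∧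
    (∀ p ∈ U, ∑ i, lam i p • W.form i p = 0) ∧
    (∀ i, ∀ p ∈ U, extD (fun q => lam i q • W.form i q) p = 0) }
  zero_mem' := by
    refine ⟨fun i => contDiffOn_const, fun _ _ _ => rfl, fun p _ => by simp, fun i p _ => ?_⟩
    simpa using extD_const_smul 0 (W.form i) p
  add_mem' := by
    rintro f g ⟨hf1, hf2, hf3, hf4⟩ ⟨hg1, hg2, hg3, hg4⟩
    refine ⟨fun i => (hf1 i).add (hg1 i), fun i p hp => by simp [hf2 i p hp, hg2 i p hp],
      fun p hp => by simp [add_smul, Finset.sum_add_distrib, hf3 p hp, hg3 p hp],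
      fun i p hp => ?_⟩
    have h := extD_add (W.differentiableAt_smul_form (hf1 i) i hp)
      (W.differentiableAt_smul_form (hg1 i) i hp)
    rw [hf4 i p hp, hg4 i p hp, add_zero] at h
    simpa [add_smul] using h
  smul_mem' := by
    rintro c f ⟨hf1, hf2, hf3, hf4⟩
    refine ⟨fun i => contDiffOn_const.mul (hf1 i), fun i p hp => by simp [hf2 i p hp],
      fun p hp => by simp [mul_smul, ← Finset.smul_sum, hf3 p hp], fun i p hp => ?_⟩
    have h := extD_const_smul c (fun q => f i q • W.form i q) p
    rw [hf4 i p hp, smul_zero] at h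
    simpa [mul_smul] using h

/-- The rank of a web on `U`: the dimension of the solution space of its abelian equation. -/
def rank (W : PlanarWeb d U) : Cardinal :=
  Module.rank ℝ W.abelianRelations

/-- The web has rank `n` near the point `p`: its rank is `n` on all sufficiently small
neighbourhoods `ball p r` of `p`. -/
def HasRankNear (W : PlanarWeb d U) (p : Plane) (n : ℕ) : Prop :=
  ∀ᶠ r : ℝ in 𝓝[>] 0, (W.restrict ⟨Metric.ball p r, Metric.isOpen_ball⟩).rank = n

end PlanarWeb

/-- A normalization of a planar `4`-web: the `1`-forms of the web are rescaled by nonvanishing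
smooth functions, `ω₁ = scale 0 • form 0`, …, `ω₄ = scale 3 • form 3`, in such a way that
`ω₁ + ω₂ + ω₃ = 0` and `a ω₁ + ω₂ + ω₄ = 0`.  The function `a` is the basic invariant. -/
structure Normalization {U : Opens Plane} (W : PlanarWeb 4 U) where
  scale : Fin 4 → Plane → ℝ
  smooth_scale : ∀ i, ContDiffOn ℝ ∞ (scale i) U
  scale_ne_zero : ∀ i, ∀ p ∈ U, scale i p ≠ 0
  a : Plane → ℝ
  normalized₃ : ∀ p ∈ U, scale 0 p • W.form 0 p + scale 1 p • W.form 1 p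
    + scale 2 p • W.form 2 p = 0
  normalized₄ : ∀ p ∈ U, a p • (scale 0 p • W.form 0 p) + scale 1 p • W.form 1 p
    + scale 3 p • W.form 3 p = 0

namespace Normalization

variable {U : Opens Plane} {W : PlanarWeb 4 U}

/-- The normalized forms: `coframe 0, …, coframe 3` are `ω₁, …, ω₄`. -/
def coframe (N : Normalization W) (i : Fin 4) : OneForm :=
  fun p => N.scale i p • W.form i p

/-- The value of `ω₁ ∧ ω₂` on the standard basis of the plane. -/
def det (N : Normalization W) (p : Plane) : ℝ :=
  N.coframe 0 p (1, 0) * N.coframe 1 p (0, 1) - N.coframe 0 p (0, 1) * N.coframe 1 p (1, 0)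

/-- The vector field `∂₁` of the frame dual to `ω₁, ω₂`. -/
def e₁ (N : Normalization W) (p : Plane) : Plane :=
  (N.det p)⁻¹ • (N.coframe 1 p (0, 1), -N.coframe 1 p (1, 0))

/-- The vector field `∂₂` of the frame dual to `ω₁, ω₂`. -/
def e₂ (N : Normalization W) (p : Plane) : Plane :=
  (N.det p)⁻¹ • (-N.coframe 0 p (0, 1), N.coframe 0 p (1, 0))

/-- The vector field `∂₃ = ∂₂ - ∂₁`, tangent to the third foliation. -/
def e₃ (N : Normalization W) (p : Plane) : Plane := N.e₂ p - N.e₁ p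

/-- The vector field `∂₄ = a ∂₂ - ∂₁`, tangent to the fourth foliation. -/
def e₄ (N : Normalization W) (p : Plane) : Plane := N.a p • N.e₂ p - N.e₁ p

/-- The connection form of the Chern connection of the `3`-subweb `[1,2,3]`: the unique `1`-form
with `dωᵢ = ωᵢ ∧ γ` for `i = 1, 2, 3`.  Writing `γ = g₁ ω₁ + g₂ ω₂`, these equations say
`g₁ = -dω₂(∂₁, ∂₂)` and `g₂ = dω₁(∂₁, ∂₂)`. -/
def γ (N : Normalization W) : OneForm := fun p =>
  (-extD (N.coframe 1) p ![N.e₁ p, N.e₂ p]) • N.coframe 0 p + extD (N.coframe 0) p ![N.e₁ p, N.e₂ p] • N.coframe 1 p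

/-- The curvature function of the `3`-subweb `[1,2,3]`, defined by `dγ = K ω₁ ∧ ω₂`. -/
def K (N : Normalization W) (p : Plane) : ℝ :=
  extD N.γ p ![N.e₁ p, N.e₂ p]

/-- The covariant derivative along the vector field `X`, with respect to the Chern connection, of
a function `u` of weight `w`: `X(u) - w γ(X) u`. -/
def δ (N : Normalization W) (w : ℝ) (X : Plane → Plane) (u : Plane → ℝ) (p : Plane) : ℝ :=
  fderiv ℝ u p (X p) - w * N.γ p (X p) * u p

/-! Covariant derivatives of the basic invariant, a function of weight `0`; every covariant
differentiation raises the weight by one. -/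

def a₁ (N : Normalization W) : Plane → ℝ := N.δ 0 N.e₁ N.a
def a₂ (N : Normalization W) : Plane → ℝ := N.δ 0 N.e₂ N.a
def a₃ (N : Normalization W) : Plane → ℝ := N.δ 0 N.e₃ N.a
def a₄ (N : Normalization W) : Plane → ℝ := N.δ 0 N.e₄ N.a

def a₁₁ (N : Normalization W) : Plane → ℝ := N.δ 1 N.e₁ N.a₁
/-- `δ₁ δ₂ a`, which equals `δ₂ δ₁ a` because `a` has weight `0`. -/
def a₁₂ (N : Normalization W) : Plane → ℝ := N.δ 1 N.e₁ N.a₂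
def a₂₁ (N : Normalization W) : Plane → ℝ := N.δ 1 N.e₂ N.a₁
def a₂₂ (N : Normalization W) : Plane → ℝ := N.δ 1 N.e₂ N.a₂

/-- The symmetrized third covariant derivative
`(δ₁ δ₁ δ₂ a + δ₁ δ₂ δ₁ a + δ₂ δ₁ δ₁ a) / 3`. -/
def a₁₁₂ (N : Normalization W) (p : Plane) : ℝ :=
  (N.δ 2 N.e₁ N.a₁₂ p + N.δ 2 N.e₁ N.a₂₁ p + N.δ 2 N.e₂ N.a₁₁ p) / 3

/-- The symmetrized third covariant derivative
`(δ₁ δ₂ δ₂ a + δ₂ δ₁ δ₂ a + δ₂ δ₂ δ₁ a) / 3`. -/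
def a₁₂₂ (N : Normalization W) (p : Plane) : ℝ :=
  (N.δ 2 N.e₁ N.a₂₂ p + N.δ 2 N.e₂ N.a₁₂ p + N.δ 2 N.e₂ N.a₂₁ p) / 3

/-- The covariant derivative `K₃` of the curvature function, a function of weight `2`. -/
def K₃ (N : Normalization W) : Plane → ℝ := N.δ 2 N.e₃ N.K
/-- The covariant derivative `K₄` of the curvature function, a function of weight `2`. -/
def K₄ (N : Normalization W) : Plane → ℝ := N.δ 2 N.e₄ N.K

/-- The three formulas for `K`, `K₃` and `K₄` at the point `p`. -/
def FormulasAt (N : Normalization W) (p : Plane) : Prop :=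
  let a := N.a p
  let a₁ := N.a₁ p
  let a₂ := N.a₂ p
  let a₃ := N.a₃ p
  let a₄ := N.a₄ p
  let a₁₁ := N.a₁₁ p
  let a₁₂ := N.a₁₂ p
  let a₂₂ := N.a₂₂ p
  let a₁₁₂ := N.a₁₁₂ p
  let a₁₂₂ := N.a₁₂₂ p
  let K := N.K p
  K = (-a₁₁ + a * a₂₂ + 2 * (1 - a) * a₁₂) / (4 * a * (1 - a))
      + ((1 - 2 * a) * a₁ ^ 2 + a ^ 2 * a₂ ^ 2 - 2 * (1 - a) ^ 2 * a₁ * a₂)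
        / (4 * (1 - a) ^ 2 * a ^ 2) ∧
  N.K₃ p = ((4 - a) * a₁ - (11 - 20 * a + 12 * a ^ 2) * a₂) / (3 * (1 - a) * a) * K
      + (a₁₂₂ - a₁₁₂) / a + a₄ * a₂₂ / a ^ 2
      + (2 * a - 1) * a₄ * a₁₂ / ((1 - a) * a ^ 2)
      + (2 * a₂ ^ 2 * (1 - a) * a₁ + a₂ ^ 2 * a₄) / ((1 - a) * a ^ 2) ∧
  N.K₄ p = (a * a₄ - (1 - a) * a₁ - 2 * a * a₃) / ((1 - a) * a) * K

end Normalization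

end

/-! Abelian relations are the parallel sections of a linear connection of rank three, and the three
formulas say that this connection is flat.

Write the relation in the normalized coframe and put `u = λ₃`, `v = λ₄`. The condition `∑ λᵢ ωᵢ = 0`
forces `λ₁ = u + a v` and `λ₂ = u + v`, and closedness of the terms becomes `δ₁u = δ₂u = w`, `δ₁v =
-w`, `a δ₂v = -(a₂ v + w)`, where `w` is a name for the common value. The Ricci identities for `u`
and `v` are two linear equations in `δ₁w` and `δ₂w` with determinant `a - 1`. Since `a ≠ 1` they can
be solved (`IsSolution.δ_w`), so the system closes up in the three unknowns `(u, v, w)`; the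
resulting connection is `conn`.

Its curvature takes values in the `w`-direction only, with coefficients `obstructionU`,
`obstructionV`, `obstructionW` (`connCurvature_conn`). These are an invertible triangular
combination of the differences of the two sides of the three formulas, so flatness at a point is
equivalent to `FormulasAt` (`formulasAt_iff_obstructions`).

On a connected domain a parallel section is determined by its value at one point, so `evalJet` is
injective and the rank is at most three. If the rank is three, every vector of every fibre is the
value of a parallel section; curvature annihilates such values, hence vanishes
(`formulasAt_of_rank_eq_three`). Conversely, a flat connection has local parallel sections with any
initial value (`exists_isParallelOn_ball`), and on a simply connected domain the monodromy principle
makes them global (`exists_isParallelOn_of_simplyConnected`), which gives rank three. The local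
equivalence follows by restriction to small balls, which are convex. -/

set_option maxSynthPendingDepth 3

/-! ### Linear connections, uniqueness of parallel sections, linear ODEs -/

section Connection

open Set Filter

variable {E : Type*} [NormedAddCommGroup E] [NormedSpace ℝ E]
  {X : Type*} [NormedAddCommGroup X] [NormedSpace ℝ X]

/-- `Y` is parallel on `s` for the linear connection `d - Ω` on the trivial bundle with fibre `E`:
`dY = Ω Y`. -/
def IsParallelOn (Ω : X → X →L[ℝ] E →L[ℝ] E) (Y : X → E) (s : Set X) : Prop :=
  ∀ p ∈ s, HasFDerivAt Y ((Ω p).flip (Y p)) p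

/-- The curvature of the linear connection `d - Ω`. -/
noncomputable def connCurvature (Ω : X → X →L[ℝ] E →L[ℝ] E) (p v w : X) : E →L[ℝ] E :=
  fderiv ℝ Ω p v w - fderiv ℝ Ω p w v + (Ω p w ∘L Ω p v - Ω p v ∘L Ω p w)

variable {Ω : X → X →L[ℝ] E →L[ℝ] E} {Y Z : X → E} {s t : Set X}

theorem IsParallelOn.mono (h : IsParallelOn Ω Y s) (hts : t ⊆ s) : IsParallelOn Ω Y t :=
  fun p hp => h p (hts hp)

theorem IsParallelOn.add (hY : IsParallelOn Ω Y s) (hZ : IsParallelOn Ω Z s) :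
    IsParallelOn Ω (fun p => Y p + Z p) s := fun p hp => by
  simpa using (hY p hp).fun_add (hZ p hp)

theorem IsParallelOn.sub (hY : IsParallelOn Ω Y s) (hZ : IsParallelOn Ω Z s) :
    IsParallelOn Ω (fun p => Y p - Z p) s := fun p hp => by
  simpa using (hY p hp).fun_sub (hZ p hp)

theorem IsParallelOn.const_smul (c : ℝ) (hY : IsParallelOn Ω Y s) :
    IsParallelOn Ω (fun p => c • Y p) s := fun p hp => by
  simpa using (hY p hp).fun_const_smul c

/-- Bootstrapping: if `Y` is `C^n`, then `dY = Ω Y` is `C^n`, so `Y` is `C^(n+1)`. -/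
theorem IsParallelOn.contDiffOn [FiniteDimensional ℝ X] (hs : IsOpen s) (hΩ : ContDiffOn ℝ ∞ Ω s)
    (hY : IsParallelOn Ω Y s) : ContDiffOn ℝ ∞ Y s := by
  have hd : DifferentiableOn ℝ Y s := fun p hp => (hY p hp).differentiableAt.differentiableWithinAt
  refine contDiffOn_infty.2 fun n => ?_
  induction n with
  | zero => exact contDiffOn_zero.2 hd.continuousOn
  | succ n ih =>
    push_cast
    refine (contDiffOn_succ_iff_fderiv_of_isOpen hs).2 ⟨hd, by simp, ?_⟩
    have hn : (n : WithTop ℕ∞) ≤ ∞ := mod_cast (le_top : (n : ℕ∞) ≤ ⊤)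
    refine contDiffOn_clm_apply.2 fun v => ?_
    exact (((hΩ.of_le hn).clm_apply contDiffOn_const).clm_apply ih).congr fun p hp => by
      rw [(hY p hp).fderiv]; rfl

/-- The curvature annihilates parallel sections. -/
theorem IsParallelOn.connCurvature_apply [FiniteDimensional ℝ X] (hs : IsOpen s) (hΩ : ContDiffOn ℝ ∞ Ω s)
    (hY : IsParallelOn Ω Y s) {p : X} (hp : p ∈ s) (v w : X) :
    connCurvature Ω p v w (Y p) = 0 := by
  have hΩp : DifferentiableAt ℝ Ω p := (hΩ.contDiffAt (hs.mem_nhds hp)).differentiableAt (by simp)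
  have hsymm : IsSymmSndFDerivAt ℝ Y p :=
    ((hY.contDiffOn hs hΩ).contDiffAt (hs.mem_nhds hp)).isSymmSndFDerivAt (by
      simpa [minSmoothness_of_isRCLikeNormedField] using WithTop.coe_le_coe.2 (le_top : (2 : ℕ∞) ≤ ⊤))
  have heq : fderiv ℝ Y =ᶠ[𝓝 p] fun q => (Ω q).flip (Y q) := by
    filter_upwards [hs.mem_nhds hp] with q hq using (hY q hq).fderiv
  have hfd : DifferentiableAt ℝ (fderiv ℝ Y) p :=
    (((hY.contDiffOn hs hΩ).fderiv_of_isOpen hs (m := 1)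
      (WithTop.coe_le_coe.2 (le_top : (1 + 1 : ℕ∞) ≤ ⊤))).contDiffAt
        (hs.mem_nhds hp)).differentiableAt (by simp)
  -- The equation `dY = Ω Y` differentiated once more; antisymmetrizing in `x` and `y` turns the
  -- right side into the curvature applied to `Y`, and the left side into zero.
  have key : ∀ x y, fderiv ℝ (fderiv ℝ Y) p y x
      = fderiv ℝ Ω p y x (Y p) + Ω p x (Ω p y (Y p)) := fun x y => by
    have h1 := (hΩp.hasFDerivAt.clm_apply (hasFDerivAt_const x p)).clm_apply (hY p hp)
    have h2 := hfd.hasFDerivAt.clm_apply (hasFDerivAt_const x p)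
    have heq' : (fun q => fderiv ℝ Y q x) =ᶠ[𝓝 p] fun q => Ω q x (Y q) := by
      filter_upwards [heq] with q hq
      rw [hq]; rfl
    have h3 := congrArg (fun L => L y) (h2.unique (h1.congr_of_eventuallyEq heq'))
    simpa [add_comm] using h3
  have h := hsymm v w
  rw [key, key, ← sub_eq_zero] at h
  simp only [connCurvature, add_apply, sub_apply, ContinuousLinearMap.comp_apply]
  rw [← h]
  abel

/-- Grönwall on the right half of the interval. The hypotheses are kept on the whole interval so
that they are invariant under reflection in `t₀`. -/
theorem norm_le_gronwallBound_right {f f' : ℝ → E} {δ K ε t₀ r : ℝ} (hδ : 0 ≤ δ) (hε : 0 ≤ ε)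
    (hK : 0 ≤ K)
    (hf : ∀ t ∈ Icc (t₀ - r) (t₀ + r), HasDerivWithinAt f (f' t) (Icc (t₀ - r) (t₀ + r)) t)
    (h0 : ‖f t₀‖ ≤ δ) (bound : ∀ t ∈ Icc (t₀ - r) (t₀ + r), ‖f' t‖ ≤ K * ‖f t‖ + ε) :
    ∀ t ∈ Icc t₀ (t₀ + r), ‖f t‖ ≤ gronwallBound δ K ε r := by
  intro t ht
  have hr : 0 ≤ r := by linarith [ht.1, ht.2]
  have hsub : Icc t₀ (t₀ + r) ⊆ Icc (t₀ - r) (t₀ + r) := Icc_subset_Icc_left (by linarith)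
  refine (norm_le_gronwallBound_of_norm_deriv_right_le (f := f) (f' := f') (δ := δ) (K := K)
    (ε := ε) (a := t₀) (b := t₀ + r) (fun x hx => ((hf x (hsub hx)).continuousWithinAt.mono hsub))
    (fun x hx => ?_) h0 (fun x hx => bound x (hsub (Ico_subset_Icc_self hx))) t ht).trans
    (gronwallBound_mono hδ hε hK (by linarith [ht.2]))
  exact (hf x (hsub (Ico_subset_Icc_self hx))).mono_of_mem_nhdsWithin
    (mem_of_superset (Icc_mem_nhdsGE hx.2) (Icc_subset_Icc_left (by linarith [hx.1])))

/-- The reflection `t ↦ 2 t₀ - t` carries the left half to the right half. -/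
theorem norm_le_gronwallBound_two_sided {f f' : ℝ → E} {δ K ε t₀ r : ℝ} (hδ : 0 ≤ δ) (hε : 0 ≤ ε)
    (hK : 0 ≤ K)
    (hf : ∀ t ∈ Icc (t₀ - r) (t₀ + r), HasDerivWithinAt f (f' t) (Icc (t₀ - r) (t₀ + r)) t)
    (h0 : ‖f t₀‖ ≤ δ) (bound : ∀ t ∈ Icc (t₀ - r) (t₀ + r), ‖f' t‖ ≤ K * ‖f t‖ + ε) :
    ∀ t ∈ Icc (t₀ - r) (t₀ + r), ‖f t‖ ≤ gronwallBound δ K ε r := by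
  intro t ht
  rcases le_total t₀ t with h | h
  · exact norm_le_gronwallBound_right hδ hε hK hf h0 bound t ⟨h, ht.2⟩
  · have hmap : MapsTo (fun s => 2 * t₀ - s) (Icc (t₀ - r) (t₀ + r)) (Icc (t₀ - r) (t₀ + r)) :=
      fun s hs => ⟨by linarith [hs.2], by linarith [hs.1]⟩
    have h' := norm_le_gronwallBound_right (f := fun s => f (2 * t₀ - s))
      (f' := fun s => -f' (2 * t₀ - s)) (t₀ := t₀) (r := r) hδ hε hK (fun s hs => ?_)
      (by ring_nf; exact h0) (fun s hs => by simpa using bound _ (hmap hs)) (2 * t₀ - t)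
      ⟨by linarith, by linarith [ht.1]⟩
    · simpa using h'
    · have := (hf _ (hmap hs)).scomp s ((hasDerivAt_id s).const_sub (2 * t₀)).hasDerivWithinAt hmap
      rw [neg_one_smul] at this
      exact this

/-- Along the segment from `p` to `q` the section solves a linear ODE with bounded coefficient and
zero initial value, so it vanishes by Grönwall. -/
theorem IsParallelOn.eq_zero_of_convex {C : ℝ} (hs : Convex ℝ s) (hC : ∀ p ∈ s, ‖Ω p‖ ≤ C)
    (hY : IsParallelOn Ω Y s) {p q : X} (hp : p ∈ s) (hq : q ∈ s) (h0 : Y p = 0) : Y q = 0 := by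
  have hC0 : 0 ≤ C := (norm_nonneg (Ω p)).trans (hC p hp)
  have hmem : ∀ t ∈ Icc (0 : ℝ) 1, p + t • (q - p) ∈ s := fun t ht =>
    hs.add_smul_sub_mem hp hq ht
  have hder : ∀ t ∈ Icc (0 : ℝ) 1, HasDerivAt (fun t : ℝ => Y (p + t • (q - p)))
      (Ω (p + t • (q - p)) (q - p) (Y (p + t • (q - p)))) t := fun t ht => by
    have h1 : HasDerivAt (fun t : ℝ => p + t • (q - p)) (q - p) t := by
      simpa using ((hasDerivAt_id t).smul_const (q - p)).const_add p
    exact (hY _ (hmem t ht)).comp_hasDerivAt t h1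
  have := eq_zero_of_abs_deriv_le_mul_abs_self_of_eq_zero_right (K := C * ‖q - p‖)
    (fun t ht => (hder t ht).continuousAt.continuousWithinAt)
    (fun t ht => (hder t (Ico_subset_Icc_self ht)).hasDerivWithinAt) (by simpa using h0)
    (fun t ht => ?_) 1 (by simp)
  · simpa using this
  · refine (ContinuousLinearMap.le_opNorm _ _).trans ?_
    gcongr
    refine (ContinuousLinearMap.le_opNorm _ _).trans ?_
    gcongr
    exact hC _ (hmem t (Ico_subset_Icc_self ht))

/-- A parallel section on a connected open set which vanishes at one point is zero. -/
theorem IsParallelOn.eq_zero (hs : IsOpen s) (hs' : IsPreconnected s) (hΩ : ContinuousOn Ω s)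
    (hY : IsParallelOn Ω Y s) {p q : X} (hp : p ∈ s) (hq : q ∈ s) (h0 : Y p = 0) : Y q = 0 := by
  have key : ∀ x ∈ s, ∃ r > 0, ∀ y ∈ Metric.ball x r, Y y = 0 →
      ∀ z ∈ Metric.ball x r, Y z = 0 := by
    intro x hx
    have hcx : ContinuousAt Ω x := hΩ.continuousAt (hs.mem_nhds hx)
    have h1 : ∀ᶠ y in 𝓝 x, y ∈ s ∧ ‖Ω y‖ ≤ ‖Ω x‖ + 1 :=
      Filter.Eventually.and (hs.mem_nhds hx)
        ((Filter.Tendsto.eventually_lt_const (lt_add_one ‖Ω x‖)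
          ((continuous_norm (E := X →L[ℝ] E →L[ℝ] E)).continuousAt.comp hcx)).mono
            fun _ h => le_of_lt h)
    obtain ⟨r, hr, hb⟩ := Metric.eventually_nhds_iff_ball.1 h1
    exact ⟨r, hr, fun y hy h0 z hz => IsParallelOn.eq_zero_of_convex (convex_ball x r)
      (fun y hy => (hb y hy).2) (hY.mono fun y hy => (hb y hy).1) hy hz h0⟩
  have hint : ∀ {x}, x ∈ interior {x | Y x = 0} → Y x = 0 := fun hx => by
    simpa using interior_subset hx
  -- Connectedness: the interior of the zero set contains `p` and is relatively closed in `s`, both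
  -- by propagation of a zero over a small ball.
  have hsub : s ⊆ interior {x | Y x = 0} := by
    refine hs'.subset_of_closure_inter_subset isOpen_interior ⟨p, hp, ?_⟩ ?_
    · obtain ⟨r, hr, h⟩ := key p hp
      exact mem_interior.2 ⟨_, fun z hz => h p (Metric.mem_ball_self hr) h0 z hz,
        Metric.isOpen_ball, Metric.mem_ball_self hr⟩
    · rintro x ⟨hx, hxs⟩
      obtain ⟨r, hr, h⟩ := key x hxs
      obtain ⟨y, hy, hy'⟩ := mem_closure_iff_nhds.1 hx _ (Metric.ball_mem_nhds x hr)
      exact mem_interior.2 ⟨_, fun z hz => h y hy (hint hy') z hz,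
        Metric.isOpen_ball, Metric.mem_ball_self hr⟩
  exact hint (hsub hq)

/-- Solutions of a linear differential equation on a short interval. -/
theorem exists_linear_ode_solution [CompleteSpace E] {B : ℝ → E →L[ℝ] E} {C r t₀ : ℝ} (hr : 0 ≤ r)
    (hB : ContinuousOn B (Icc (t₀ - r) (t₀ + r))) (hC : ∀ t ∈ Icc (t₀ - r) (t₀ + r), ‖B t‖ ≤ C)
    (hCr : C * r ≤ 1 / 2) (y : E) :
    ∃ f : ℝ → E, f t₀ = y ∧ ∀ t ∈ Icc (t₀ - r) (t₀ + r),
      HasDerivWithinAt f (B t (f t)) (Icc (t₀ - r) (t₀ + r)) t := by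
  have hmem : t₀ ∈ Icc (t₀ - r) (t₀ + r) := ⟨by linarith, by linarith⟩
  have hC0 : 0 ≤ C := (norm_nonneg _).trans (hC t₀ hmem)
  -- On the ball of radius `‖y‖` about `y` one has `‖x‖ ≤ 2‖y‖`, so the speed is at most `2C‖y‖`;
  -- the condition `C * r ≤ 1 / 2` keeps the solution inside that ball.
  have hP : IsPicardLindelof (fun t x => B t x) (⟨t₀, hmem⟩ : Icc (t₀ - r) (t₀ + r)) y
      ‖y‖₊ 0 (NNReal.mk (2 * C * ‖y‖) (by positivity)) (NNReal.mk C hC0) := by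
    refine ⟨fun t ht => ?_, fun x _ => hB.clm_apply continuousOn_const, fun t ht x hx => ?_, ?_⟩
    · refine LipschitzWith.lipschitzOnWith ?_
      refine (B t).lipschitz.weaken ?_
      exact hC t ht
    · have hx' : ‖x‖ ≤ 2 * ‖y‖ := by
        have h1 : ‖x - y‖ ≤ ‖y‖ := by simpa [dist_eq_norm] using hx
        have h2 := norm_add_le (x - y) y
        rw [sub_add_cancel] at h2
        linarith
      calc ‖B t x‖ ≤ ‖B t‖ * ‖x‖ := (B t).le_opNorm x
        _ ≤ C * (2 * ‖y‖) := by gcongr; exact hC t ht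
        _ = 2 * C * ‖y‖ := by ring
    · have : 2 * C * ‖y‖ * r ≤ ‖y‖ := by
        nlinarith [norm_nonneg y, mul_le_mul_of_nonneg_right hCr (norm_nonneg y)]
      simpa using this
  exact hP.exists_eq_forall_mem_Icc_hasDerivWithinAt₀

end Connection

/-! ### Local parallel sections of a flat connection on a square -/

section Frobenius

open Set Filter

theorem gronwallBound_self_nonneg {K x : ℝ} (hK : 0 ≤ K) (hx : 0 ≤ x) : 0 ≤ gronwallBound 1 K 1 x := by
  have h := gronwallBound_mono (δ := 1) (ε := 1) zero_le_one zero_le_one hK hx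
  rw [gronwallBound_x0] at h
  linarith

/-- The bound is homogeneous in initial error and forcing together; this extracts the factor `|h|`
from the transport estimate. -/
theorem gronwallBound_mul (η K x : ℝ) : gronwallBound η K η x = η * gronwallBound 1 K 1 x := by
  unfold gronwallBound
  split_ifs <;> ring

variable {E : Type*} [NormedAddCommGroup E] [NormedSpace ℝ E] {Ω : Plane → Plane →L[ℝ] E →L[ℝ] E}

theorem mem_closedBall_plane {x y x₀ y₀ r : ℝ} : ((x, y) : Plane) ∈ Metric.closedBall (x₀, y₀) r ↔
    x ∈ Icc (x₀ - r) (x₀ + r) ∧ y ∈ Icc (y₀ - r) (y₀ + r) := by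
  rw [← closedBall_prod_same, mem_prod, Real.closedBall_eq_Icc, Real.closedBall_eq_Icc]

theorem mem_ball_plane {x y x₀ y₀ r : ℝ} : ((x, y) : Plane) ∈ Metric.ball (x₀, y₀) r ↔
    x ∈ Ioo (x₀ - r) (x₀ + r) ∧ y ∈ Ioo (y₀ - r) (y₀ + r) := by
  rw [← ball_prod_same, mem_prod, Real.ball_eq_Ioo, Real.ball_eq_Ioo]

theorem norm_apply_le_of_norm_le {L : Plane →L[ℝ] E →L[ℝ] E} {c : ℝ} (hL : ‖L‖ ≤ c) {v : Plane}
    (hv : ‖v‖ ≤ 1) : ‖L v‖ ≤ c :=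
  (L.le_opNorm v).trans ((mul_le_of_le_one_right (norm_nonneg _) hv).trans hL)

theorem norm_plane_one_zero : ‖((1, 0) : Plane)‖ ≤ 1 := by simp [Prod.norm_def]
theorem norm_plane_zero_one : ‖((0, 1) : Plane)‖ ≤ 1 := by simp [Prod.norm_def]

/-- The identity behind the transport estimate: comparison of the sections along two neighbouring
vertical lines. -/
theorem vertical_defect_identity {x h t : ℝ} {a b : E}
    (hflat : connCurvature Ω (x, t) (1, 0) (0, 1) = 0) :
    Ω (x + h, t) (0, 1) b - Ω (x, t) (0, 1) a
      - h • (fderiv ℝ Ω (x, t) (0, 1) (1, 0) a + Ω (x, t) (1, 0) (Ω (x, t) (0, 1) a)) =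
    Ω (x + h, t) (0, 1) (b - a - h • Ω (x, t) (1, 0) a)
      + ((Ω (x + h, t) - Ω (x, t) - fderiv ℝ Ω (x, t) (h, 0)) (0, 1) a
      + h • (Ω (x + h, t) - Ω (x, t)) (0, 1) (Ω (x, t) (1, 0) a)) := by
  have h1 : ((h, 0) : Plane) = h • (1, 0) := by simp
  have h2 := congrArg (fun L => h • L a) hflat
  simp only [connCurvature, add_apply, sub_apply, ContinuousLinearMap.comp_apply, zero_apply,
    smul_zero, smul_add, smul_sub] at h2
  rw [h1]
  simp only [map_smul, sub_apply, smul_apply, map_sub, smul_add, smul_sub]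
  rw [← sub_eq_zero, ← h2]
  abel

variable {x₀ y₀ r C : ℝ}

/-- The derivative of vertical parallel transport with respect to the base point, uniformly along
the vertical line. -/
theorem eventually_norm_vertical_defect_le (hr : 0 < r) (hC0 : 0 ≤ C)
    (hC : ∀ p ∈ Metric.closedBall (x₀, y₀) r, ‖Ω p‖ ≤ C)
    (hL : ∀ p ∈ Metric.closedBall (x₀, y₀) r, ∀ q ∈ Metric.closedBall (x₀, y₀) r,
      ‖Ω q - Ω p‖ ≤ C * ‖q - p‖)
    (hT : ∀ p ∈ Metric.closedBall (x₀, y₀) r, ∀ q ∈ Metric.closedBall (x₀, y₀) r,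
      ‖Ω q - Ω p - fderiv ℝ Ω p (q - p)‖ ≤ C * ‖q - p‖ * ‖q - p‖)
    (hd : ∀ p ∈ Metric.closedBall (x₀, y₀) r, DifferentiableAt ℝ Ω p)
    (hflat : ∀ p ∈ Metric.closedBall (x₀, y₀) r, connCurvature Ω p (1, 0) (0, 1) = 0)
    {f : ℝ → E} {G : ℝ → ℝ → E}
    (hf : ∀ x ∈ Icc (x₀ - r) (x₀ + r),
      HasDerivWithinAt f (Ω (x, y₀) (1, 0) (f x)) (Icc (x₀ - r) (x₀ + r)) x)
    (hG0 : ∀ x ∈ Icc (x₀ - r) (x₀ + r), G x y₀ = f x)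
    (hG : ∀ x ∈ Icc (x₀ - r) (x₀ + r), ∀ t ∈ Icc (y₀ - r) (y₀ + r),
      HasDerivWithinAt (G x) (Ω (x, t) (0, 1) (G x t)) (Icc (y₀ - r) (y₀ + r)) t)
    {x : ℝ} (hx : x ∈ Ioo (x₀ - r) (x₀ + r)) {ε : ℝ} (hε : 0 < ε) :
    ∀ᶠ h in 𝓝 (0 : ℝ), ∀ t ∈ Icc (y₀ - r) (y₀ + r),
      ‖G (x + h) t - G x t - h • Ω (x, t) (1, 0) (G x t)‖ ≤ ε * |h| := by
  have hxI : x ∈ Icc (x₀ - r) (x₀ + r) := Ioo_subset_Icc_self hx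
  have hmem : ∀ {x t : ℝ}, x ∈ Icc (x₀ - r) (x₀ + r) → t ∈ Icc (y₀ - r) (y₀ + r) →
      ((x, t) : Plane) ∈ Metric.closedBall ((x₀, y₀) : Plane) r :=
    fun hx ht => mem_closedBall_plane.2 ⟨hx, ht⟩
  obtain ⟨M, hM⟩ := (isCompact_Icc (a := y₀ - r) (b := y₀ + r)).exists_bound_of_continuousOn
    (fun t ht => (hG x hxI t ht).continuousWithinAt)
  have hM0 : 0 ≤ M := (norm_nonneg _).trans (hM y₀ ⟨by linarith, by linarith⟩)
  set Γ := gronwallBound 1 C 1 r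
  have hΓ : 0 ≤ Γ := gronwallBound_self_nonneg hC0 hr.le
  -- Initial error and forcing will both be at most `ε' * |h|`, so Grönwall yields `ε' * |h| * Γ`.
  -- The `+ 1` avoids dividing by zero.
  set ε' := ε / (Γ + 1)
  have hε' : 0 < ε' := by positivity
  have hεΓ : ε' * Γ ≤ ε := by
    rw [div_mul_eq_mul_div, div_le_iff₀ (by positivity)]
    nlinarith
  have hfx : HasDerivAt f (Ω (x, y₀) (1, 0) (f x)) x :=
    (hf x hxI).hasDerivAt (Icc_mem_nhds hx.1 hx.2)
  have e1 : ∀ᶠ h in 𝓝 (0 : ℝ), x + h ∈ Icc (x₀ - r) (x₀ + r) := by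
    have : Tendsto (fun h : ℝ => x + h) (𝓝 0) (𝓝 x) := by
      have := (continuous_const_add x).tendsto 0
      simpa using this
    exact this.eventually (Icc_mem_nhds hx.1 hx.2)
  have e2 : ∀ᶠ h in 𝓝 (0 : ℝ), ‖f (x + h) - f x - h • Ω (x, y₀) (1, 0) (f x)‖ ≤ ε' * ‖h‖ :=
    Asymptotics.isLittleO_iff.1 (hasDerivAt_iff_isLittleO_nhds_zero.1 hfx) hε'
  -- The forcing is quadratic in `h`: the Taylor remainder of `Ω` contributes `C * M`, its Lipschitz
  -- variation `C * (C * M)`.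
  have e3 : ∀ᶠ h in 𝓝 (0 : ℝ), (C * M + C * (C * M)) * |h| ≤ ε' := by
    have : Tendsto (fun h : ℝ => (C * M + C * (C * M)) * |h|) (𝓝 0) (𝓝 0) := by
      have := ((continuous_abs (G := ℝ)).const_mul (C * M + C * (C * M))).tendsto 0
      simpa using this
    exact (this.eventually_lt_const hε').mono fun _ h => le_of_lt h
  filter_upwards [e1, e2, e3] with h h1 h2 h3 t ht
  have hη : 0 ≤ ε' * |h| := by positivity
  have hderA : ∀ t ∈ Icc (y₀ - r) (y₀ + r), HasDerivAt (fun t => Ω (x, t) (1, 0))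
      (fderiv ℝ Ω (x, t) (0, 1) (1, 0)) t := fun t ht => by
    have hline : HasDerivAt (fun t : ℝ => ((x, t) : Plane)) (0, 1) t :=
      (hasDerivAt_const t x).prodMk (hasDerivAt_id t)
    have := ((hd _ (hmem hxI ht)).hasFDerivAt.comp_hasDerivAt t hline).clm_apply
      (hasDerivAt_const t ((1, 0) : Plane))
    simpa using this
  have hder : ∀ t ∈ Icc (y₀ - r) (y₀ + r), HasDerivWithinAt
      (fun t => G (x + h) t - G x t - h • Ω (x, t) (1, 0) (G x t))
      (Ω (x + h, t) (0, 1) (G (x + h) t) - Ω (x, t) (0, 1) (G x t)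
        - h • (fderiv ℝ Ω (x, t) (0, 1) (1, 0) (G x t)
          + Ω (x, t) (1, 0) (Ω (x, t) (0, 1) (G x t)))) (Icc (y₀ - r) (y₀ + r)) t := fun t ht =>
    ((hG _ h1 t ht).fun_sub (hG x hxI t ht)).fun_sub
      (((hderA t ht).hasDerivWithinAt.clm_apply (hG x hxI t ht)).fun_const_smul h)
  have key := norm_le_gronwallBound_two_sided hη hη hC0 hder
    (by rw [hG0 _ h1, hG0 _ hxI]; simpa using h2) (fun t ht => ?_) t ht
  · rw [gronwallBound_mul] at key
    refine key.trans ?_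
    calc ε' * |h| * Γ = ε' * Γ * |h| := by ring
      _ ≤ ε * |h| := by gcongr
  · have hq := hmem h1 ht
    have hp := hmem hxI ht
    have hqp : ((x + h, t) : Plane) - (x, t) = (h, 0) := by simp
    have hn : ‖((h, 0) : Plane)‖ = |h| := by simp [Prod.norm_def]
    have hL' := hL _ hp _ hq
    have hT' := hT _ hp _ hq
    rw [hqp, hn] at hL' hT'
    have hGM : ‖G x t‖ ≤ M := hM t ht
    have b1 : ‖(Ω (x + h, t) - Ω (x, t) - fderiv ℝ Ω (x, t) (h, 0)) (0, 1) (G x t)‖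
        ≤ C * |h| * |h| * M :=
      (ContinuousLinearMap.le_opNorm _ _).trans (mul_le_mul
        (norm_apply_le_of_norm_le hT' norm_plane_zero_one) hGM (norm_nonneg _) (by positivity))
    have b2 : ‖Ω (x, t) (1, 0) (G x t)‖ ≤ C * M :=
      (ContinuousLinearMap.le_opNorm _ _).trans (mul_le_mul
        (norm_apply_le_of_norm_le (hC _ hp) norm_plane_one_zero) hGM (norm_nonneg _) hC0)
    have b3 : ‖h • (Ω (x + h, t) - Ω (x, t)) (0, 1) (Ω (x, t) (1, 0) (G x t))‖
        ≤ |h| * (C * |h| * (C * M)) := by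
      rw [norm_smul, Real.norm_eq_abs]
      gcongr
      exact (ContinuousLinearMap.le_opNorm _ _).trans (mul_le_mul
        (norm_apply_le_of_norm_le hL' norm_plane_zero_one) b2 (norm_nonneg _) (by positivity))
    have b4 : ‖Ω (x + h, t) (0, 1) (G (x + h) t - G x t - h • Ω (x, t) (1, 0) (G x t))‖
        ≤ C * ‖G (x + h) t - G x t - h • Ω (x, t) (1, 0) (G x t)‖ :=
      (ContinuousLinearMap.le_opNorm _ _).trans (mul_le_mul_of_nonneg_right
        (norm_apply_le_of_norm_le (hC _ hq) norm_plane_zero_one) (norm_nonneg _))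
    -- Flatness cancels the terms of first order in `h`: the defect `D` satisfies `D' = Ω D` plus a
    -- forcing of size `h²`.
    rw [vertical_defect_identity (hflat _ hp)]
    refine (norm_add_le _ _).trans (add_le_add b4 ((norm_add_le _ _).trans
      ((add_le_add b1 b3).trans ?_)))
    calc C * |h| * |h| * M + |h| * (C * |h| * (C * M)) = (C * M + C * (C * M)) * |h| * |h| := by ring
      _ ≤ ε' * |h| := by gcongr

/-- A flat connection on a small square has parallel sections with arbitrary initial value. -/
theorem exists_isParallelOn_ball_of_bounds [CompleteSpace E] (hr : 0 < r) (hC0 : 0 ≤ C)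
    (hCr : C * r ≤ 1 / 2)
    (hC : ∀ p ∈ Metric.closedBall (x₀, y₀) r, ‖Ω p‖ ≤ C)
    (hL : ∀ p ∈ Metric.closedBall (x₀, y₀) r, ∀ q ∈ Metric.closedBall (x₀, y₀) r,
      ‖Ω q - Ω p‖ ≤ C * ‖q - p‖)
    (hT : ∀ p ∈ Metric.closedBall (x₀, y₀) r, ∀ q ∈ Metric.closedBall (x₀, y₀) r,
      ‖Ω q - Ω p - fderiv ℝ Ω p (q - p)‖ ≤ C * ‖q - p‖ * ‖q - p‖)
    (hd : ∀ p ∈ Metric.closedBall (x₀, y₀) r, DifferentiableAt ℝ Ω p)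
    (hflat : ∀ p ∈ Metric.closedBall (x₀, y₀) r, connCurvature Ω p (1, 0) (0, 1) = 0) (e : E) :
    ∃ Y : Plane → E, Y (x₀, y₀) = e ∧ IsParallelOn Ω Y (Metric.ball (x₀, y₀) r) := by
  have hmem : ∀ {x t : ℝ}, x ∈ Icc (x₀ - r) (x₀ + r) → t ∈ Icc (y₀ - r) (y₀ + r) →
      ((x, t) : Plane) ∈ Metric.closedBall ((x₀, y₀) : Plane) r :=
    fun hx ht => mem_closedBall_plane.2 ⟨hx, ht⟩
  have hx₀ : x₀ ∈ Icc (x₀ - r) (x₀ + r) := ⟨by linarith, by linarith⟩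
  have hy₀ : y₀ ∈ Icc (y₀ - r) (y₀ + r) := ⟨by linarith, by linarith⟩
  have hΩc : ContinuousOn Ω (Metric.closedBall (x₀, y₀) r) :=
    fun p hp => (hd p hp).continuousAt.continuousWithinAt
  -- Transport horizontally through the centre, then vertically from each point reached. The
  -- vertical equation holds by construction; flatness is needed for the horizontal one off the
  -- central line.
  obtain ⟨f, hf0, hf⟩ := exists_linear_ode_solution (B := fun x => Ω (x, y₀) (1, 0)) (t₀ := x₀)
    hr.le ((hΩc.comp (by fun_prop) fun x hx => hmem hx hy₀).clm_apply continuousOn_const)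
    (fun x hx => norm_apply_le_of_norm_le (hC _ (hmem hx hy₀)) norm_plane_one_zero) hCr e
  have hGex : ∀ x, ∃ g : ℝ → E, x ∈ Icc (x₀ - r) (x₀ + r) → (g y₀ = f x ∧
      ∀ t ∈ Icc (y₀ - r) (y₀ + r),
        HasDerivWithinAt g (Ω (x, t) (0, 1) (g t)) (Icc (y₀ - r) (y₀ + r)) t) := by
    intro x
    by_cases hx : x ∈ Icc (x₀ - r) (x₀ + r)
    · obtain ⟨g, hg⟩ := exists_linear_ode_solution (B := fun t => Ω (x, t) (0, 1)) (t₀ := y₀)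
        hr.le ((hΩc.comp (by fun_prop) fun t ht => hmem hx ht).clm_apply continuousOn_const)
        (fun t ht => norm_apply_le_of_norm_le (hC _ (hmem hx ht)) norm_plane_zero_one) hCr (f x)
      exact ⟨g, fun _ => hg⟩
    · exact ⟨0, fun h => absurd h hx⟩
  choose G hG using hGex
  refine ⟨fun p => G p.1 p.2, by simpa [hf0] using (hG x₀ hx₀).1, ?_⟩
  rintro ⟨x, y⟩ hp
  obtain ⟨hx, hy⟩ := mem_ball_plane.1 hp
  have hxI := Ioo_subset_Icc_self hx
  have hyI := Ioo_subset_Icc_self hy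
  have hGy : HasDerivAt (G x) (Ω (x, y) (0, 1) (G x y)) y :=
    ((hG x hxI).2 y hyI).hasDerivAt (Icc_mem_nhds hy.1 hy.2)
  rw [hasFDerivAt_iff_isLittleO_nhds_zero, Asymptotics.isLittleO_iff]
  intro c hc
  have t1 : Tendsto (fun z : Plane => z.1) (𝓝 0) (𝓝 0) := continuous_fst.tendsto 0
  have t2 : Tendsto (fun z : Plane => z.2) (𝓝 0) (𝓝 0) := continuous_snd.tendsto 0
  have t3 : Tendsto (fun k : ℝ => y + k) (𝓝 0) (𝓝 y) := by
    simpa using (continuous_const_add y).tendsto 0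
  have e1 := t1.eventually (eventually_norm_vertical_defect_le hr hC0 hC hL hT hd hflat hf
    (fun x hx => (hG x hx).1) (fun x hx => (hG x hx).2) hx (ε := c / 3) (by positivity))
  have e2 := t2.eventually (Asymptotics.isLittleO_iff.1
    (hasDerivAt_iff_isLittleO_nhds_zero.1 hGy) (c := c / 3) (by positivity))
  have e3 : ∀ᶠ z : Plane in 𝓝 0, y + z.2 ∈ Icc (y₀ - r) (y₀ + r) :=
    t2.eventually (t3.eventually (Icc_mem_nhds hy.1 hy.2))
  have hcont : ContinuousAt (fun t => Ω (x, t) (1, 0) (G x t)) y := by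
    have h1 : ContinuousAt (fun t : ℝ => Ω (x, t)) y :=
      ContinuousAt.comp (f := fun t : ℝ => ((x, t) : Plane)) (hd _ (hmem hxI hyI)).continuousAt
        (by fun_prop)
    exact (h1.clm_apply continuousAt_const).clm_apply hGy.continuousAt
  have e4 : ∀ᶠ z : Plane in 𝓝 0, ‖Ω (x, y + z.2) (1, 0) (G x (y + z.2))
      - Ω (x, y) (1, 0) (G x y)‖ ≤ c / 3 := by
    have h0 : Tendsto (fun z : Plane => ‖Ω (x, y + z.2) (1, 0) (G x (y + z.2))
      - Ω (x, y) (1, 0) (G x y)‖) (𝓝 0) (𝓝 0) :=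
      tendsto_iff_norm_sub_tendsto_zero.1 ((hcont.tendsto.comp t3).comp t2)
    exact (h0.eventually_lt_const (by positivity)).mono fun _ h => le_of_lt h
  filter_upwards [e1, e2, e3, e4] with z h1 h2 h3 h4
  obtain ⟨h, k⟩ := z
  have hh : |h| ≤ ‖((h, k) : Plane)‖ := norm_fst_le ((h, k) : Plane)
  have hk : ‖k‖ ≤ ‖((h, k) : Plane)‖ := norm_snd_le ((h, k) : Plane)
  have hsplit : ((h, k) : Plane) = h • (1, 0) + k • (0, 1) := by simp
  -- The increment is split into a horizontal move at height `y + k`, the change of the horizontal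
  -- derivative from height `y` to `y + k`, and a vertical move; each contributes at most `c / 3`
  -- times the norm of `(h, k)`.
  have heq : G (x + h) (y + k) - G x y - (Ω (x, y)).flip (G x y) (h, k) =
      (G (x + h) (y + k) - G x (y + k) - h • Ω (x, y + k) (1, 0) (G x (y + k)))
      + (h • (Ω (x, y + k) (1, 0) (G x (y + k)) - Ω (x, y) (1, 0) (G x y))
      + (G x (y + k) - G x y - k • Ω (x, y) (0, 1) (G x y))) := by
    rw [ContinuousLinearMap.flip_apply, hsplit, map_add, map_smul, map_smul, add_apply, smul_apply,
      smul_apply, smul_sub]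
    abel
  change ‖G (x + h) (y + k) - G x y - (Ω (x, y)).flip (G x y) (h, k)‖ ≤ c * ‖((h, k) : Plane)‖
  rw [heq]
  have b1 := h1 _ h3
  have b2 : ‖h • (Ω (x, y + k) (1, 0) (G x (y + k)) - Ω (x, y) (1, 0) (G x y))‖
      ≤ |h| * (c / 3) := by
    rw [norm_smul, Real.norm_eq_abs]
    gcongr
  have c3 : 0 ≤ c / 3 := by positivity
  refine (norm_add_le _ _).trans ((add_le_add b1 ((norm_add_le _ _).trans (add_le_add b2 h2))).trans ?_)
  nlinarith [mul_le_mul_of_nonneg_left hh c3, mul_le_mul_of_nonneg_left hk c3]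

/-- Local existence of parallel sections of a flat connection. -/
theorem exists_isParallelOn_ball [CompleteSpace E] {U : Set Plane} (hU : IsOpen U)
    (hΩ : ContDiffOn ℝ ∞ Ω U) (hflat : ∀ p ∈ U, connCurvature Ω p (1, 0) (0, 1) = 0) {p : Plane}
    (hp : p ∈ U) : ∃ r > 0, Metric.ball p r ⊆ U ∧
      ∀ e : E, ∃ Y : Plane → E, Y p = e ∧ IsParallelOn Ω Y (Metric.ball p r) := by
  obtain ⟨R, hR, hRU⟩ := Metric.nhds_basis_closedBall.mem_iff.1 (hU.mem_nhds hp)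
  have hcpt : IsCompact (Metric.closedBall p R) := isCompact_closedBall p R
  have hconv : Convex ℝ (Metric.closedBall p R) := convex_closedBall p R
  have hΩ1 : ContDiffOn ℝ 1 Ω (Metric.closedBall p R) :=
    (hΩ.mono hRU).of_le (WithTop.coe_le_coe.2 (le_top : (1 : ℕ∞) ≤ ⊤))
  have hΩ2 : ContDiffOn ℝ 1 (fderiv ℝ Ω) (Metric.closedBall p R) :=
    (hΩ.fderiv_of_isOpen hU (WithTop.coe_le_coe.2 (le_top : (1 + 1 : ℕ∞) ≤ ⊤))).mono hRU
  obtain ⟨C₁, hC₁⟩ := hcpt.exists_bound_of_continuousOn hΩ1.continuousOn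
  obtain ⟨C₂, hC₂⟩ := hΩ1.exists_lipschitzOnWith one_ne_zero hconv hcpt
  obtain ⟨C₃, hC₃⟩ := hΩ2.exists_lipschitzOnWith one_ne_zero hconv hcpt
  have hC₁0 : 0 ≤ C₁ := (norm_nonneg (Ω p)).trans (hC₁ p (Metric.mem_closedBall_self hR.le))
  -- One constant dominating the norm of `Ω` and the Lipschitz constants of `Ω` and of its
  -- derivative.
  set C : ℝ := C₁ + C₂ + C₃
  have hC0 : 0 ≤ C := by positivity
  set r := min R (1 / (2 * (C + 1)))
  have hr : 0 < r := lt_min hR (by positivity)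
  have hrR : Metric.closedBall p r ⊆ Metric.closedBall p R :=
    Metric.closedBall_subset_closedBall (min_le_left _ _)
  have hd : ∀ q ∈ Metric.closedBall p r, DifferentiableAt ℝ Ω q := fun q hq =>
    (hΩ.contDiffAt (hU.mem_nhds (hRU (hrR hq)))).differentiableAt (by simp)
  refine ⟨r, hr, (Metric.ball_subset_closedBall.trans hrR).trans hRU, fun e => ?_⟩
  refine exists_isParallelOn_ball_of_bounds (x₀ := p.1) (y₀ := p.2) hr hC0 ?_ (fun q hq => ?_)
    (fun q hq q' hq' => ?_) (fun q hq q' hq' => ?_) hd (fun q hq => hflat q (hRU (hrR hq))) e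
  · calc C * r ≤ C * (1 / (2 * (C + 1))) := by gcongr; exact min_le_right _ _
      _ ≤ 1 / 2 := by
        rw [mul_one_div, div_le_div_iff₀ (by positivity) (by positivity)]
        linarith
  · exact (hC₁ q (hrR hq)).trans (by simp only [C]; linarith [C₂.2, C₃.2])
  · refine (hC₂.norm_sub_le (hrR hq') (hrR hq)).trans ?_
    gcongr
    simp only [C]
    linarith [C₃.2]
  -- The second order Taylor bound: the mean value inequality on the segment, where the derivative
  -- of `Ω` varies by at most `C * ‖q' - q‖`.
  · refine ((convex_segment q q').norm_image_sub_le_of_norm_hasFDerivWithin_le'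
      (f' := fderiv ℝ Ω) (φ := fderiv ℝ Ω q) (C := C * ‖q' - q‖) (fun z hz => ?_) (fun z hz => ?_)
      (left_mem_segment ℝ q q') (right_mem_segment ℝ q q'))
    · exact (hd z ((convex_closedBall p r).segment_subset hq hq' hz)).hasFDerivAt.hasFDerivWithinAt
    · refine (hC₃.norm_sub_le (hrR ((convex_closedBall p r).segment_subset hq hq' hz))
        (hrR hq)).trans ?_
      have hz' : ‖z - q‖ ≤ ‖q' - q‖ := by
        obtain ⟨t, ht, rfl⟩ := (segment_eq_image' ℝ q q' ▸ hz)
        simp only [add_sub_cancel_left, norm_smul, Real.norm_eq_abs]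
        rw [abs_of_nonneg ht.1]
        exact mul_le_of_le_one_left (norm_nonneg _) ht.2
      gcongr
      simp only [C]
      linarith [C₂.2]

end Frobenius

/-! ### Local systems and monodromy -/

section LocalSystem

open Set Filter

/-- The covering space of germs of sections of a local system, given by the local trivializations
`Φ i`, with locally constant transition functions. -/
def localSystemCore {X F : Type*} [TopologicalSpace X] [TopologicalSpace F]
    [DiscreteTopology F] (b : X → Set X) (hb : ∀ i, IsOpen (b i))
    (hmem : ∀ i, i ∈ b i) (Φ : X → X → F ≃ F)
    (hconst : ∀ i j, ∀ x ∈ b i ∩ b j, ∀ y ∈ b i ∩ b j, ∀ v,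
      (Φ j x).symm (Φ i x v) = (Φ j y).symm (Φ i y v)) :
    FiberBundleCore X X F where
  baseSet := b
  isOpen_baseSet := hb
  indexAt := id
  mem_baseSet_at := hmem
  coordChange i j x v := (Φ j x).symm (Φ i x v)
  coordChange_self i x _ v := (Φ i x).symm_apply_apply v
  continuousOn_coordChange i j := by
    rintro ⟨x, v⟩ hx
    refine ContinuousAt.continuousWithinAt ?_
    have hx' : x ∈ b i ∩ b j := hx.1
    -- The fibre is discrete and transitions are locally constant, so near `(x, v)` the coordinate
    -- change is a constant map.
    have h : (fun p : X × F => (Φ j p.1).symm (Φ i p.1 p.2)) =ᶠ[𝓝 (x, v)]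
        fun _ => (Φ j x).symm (Φ i x v) := by
      rw [nhds_prod_eq, nhds_discrete F]
      filter_upwards [prod_mem_prod (((hb i).inter (hb j)).mem_nhds hx')
        (mem_pure.2 (mem_singleton v))] with p hp
      rw [mem_singleton_iff.1 hp.2]
      exact hconst i j _ hp.1 _ hx' v
    exact (continuousAt_const (y := ((Φ j x).symm (Φ i x v) : F))).congr h.symm
  coordChange_comp i j k x _ v := by simp

/-- **Monodromy principle**: a local system on a simply connected space has global sections with
arbitrary initial value. -/
theorem exists_global_section {X F : Type*} [TopologicalSpace X] [SimplyConnectedSpace X]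
    [LocallyPathConnectedSpace X] (b : X → Set X) (hb : ∀ i, IsOpen (b i))
    (hmem : ∀ i, i ∈ b i) (Φ : X → X → F ≃ F)
    (hconst : ∀ i j, ∀ x ∈ b i ∩ b j, ∀ y ∈ b i ∩ b j, ∀ v,
      (Φ j x).symm (Φ i x v) = (Φ j y).symm (Φ i y v)) (x₀ : X) (v₀ : F) :
    ∃ s : X → F, s x₀ = v₀ ∧ ∀ x, ∃ v, ∀ᶠ y in 𝓝 x, s y = Φ x y v := by
  let _ : TopologicalSpace F := ⊥
  have : DiscreteTopology F := ⟨rfl⟩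
  set Z := localSystemCore b hb hmem Φ hconst
  have hcov : IsCoveringMap (Bundle.TotalSpace.proj : Bundle.TotalSpace F Z.Fiber → X) :=
    FiberBundle.isCoveringMap
  -- A lift of the identity through the covering is a global continuous choice of germs.
  obtain ⟨S, ⟨hS0, hS⟩, -⟩ := hcov.existsUnique_continuousMap_lifts (ContinuousMap.id X) x₀
    ⟨x₀, ((Φ x₀ x₀).symm v₀ : F)⟩ rfl
  have hproj : ∀ x, (S x).1 = x := fun x => congrFun hS x
  -- A fibre coordinate is the label of a local section; `ev` is the value of that section at the
  -- base point.
  let ev : Bundle.TotalSpace F Z.Fiber → F := fun z => Φ z.1 z.1 z.2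
  refine ⟨fun x => ev (S x), (congrArg ev hS0).trans ((Φ x₀ x₀).apply_symm_apply v₀), fun x => ?_⟩
  have hc : ContinuousAt (fun y => ((Z.localTriv x) (S y)).2) x := by
    refine continuous_snd.continuousAt.comp (ContinuousAt.comp ?_ S.continuous.continuousAt)
    refine (Z.localTriv x).continuousAt ?_
    rw [Bundle.Trivialization.mem_source]
    simp only [hproj]
    exact hmem x
  refine ⟨((Z.localTriv x) (S x)).2, ?_⟩
  have h1 : ∀ᶠ y in 𝓝 x, ((Z.localTriv x) (S y)).2 = ((Z.localTriv x) (S x)).2 :=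
    hc.eventually (p := fun z => z = ((Z.localTriv x) (S x)).2)
      (by rw [nhds_discrete]; exact mem_pure.2 rfl)
  filter_upwards [h1] with y hy
  rw [← hy]
  change ev (S y) = Φ x y ((Φ x (S y).1).symm (ev (S y)))
  rw [hproj, Equiv.apply_symm_apply]

end LocalSystem

/-! ### Global parallel sections on simply connected domains -/

section GlobalParallel

open Set Filter

variable {E : Type*} [NormedAddCommGroup E] [NormedSpace ℝ E] {Ω : Plane → Plane →L[ℝ] E →L[ℝ] E}

/-- A flat connection on a simply connected domain has parallel sections with arbitrary initial
value. -/
theorem exists_isParallelOn_of_simplyConnected [FiniteDimensional ℝ E] (U : Opens Plane)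
    [SimplyConnectedSpace U] (hΩ : ContDiffOn ℝ ∞ Ω U)
    (hflat : ∀ p ∈ U, connCurvature Ω p (1, 0) (0, 1) = 0) {p₀ : Plane} (hp₀ : p₀ ∈ U) (e : E) :
    ∃ Y : Plane → E, Y p₀ = e ∧ IsParallelOn Ω Y U := by
  have : CompleteSpace E := FiniteDimensional.complete ℝ E
  have : LocallyPathConnectedSpace U := U.isOpen.locallyPathConnectedSpace
  choose r hr hrU Y hY0 hY using fun i : U => exists_isParallelOn_ball U.isOpen hΩ hflat i.2
  have huniq : ∀ (s : Set Plane) (hsU : s ⊆ U) (hs : IsOpen s) (hs' : Convex ℝ s) (Y Z : Plane → E),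
      IsParallelOn Ω Y s → IsParallelOn Ω Z s → ∀ x ∈ s, Y x = Z x → ∀ y ∈ s, Y y = Z y := by
    intro s hsU hs hs' Y Z hY hZ x hx h y hy
    exact sub_eq_zero.1 ((hY.sub hZ).eq_zero hs hs'.isPreconnected (hΩ.continuousOn.mono hsU) hx hy
      (sub_eq_zero.2 h))
  -- By uniqueness, parallel transport from the centre to `x` is linear and injective, hence
  -- bijective in finite dimension.
  have hlin : ∀ i : U, ∀ x ∈ Metric.ball (i : Plane) (r i), ∃ L : E ≃ E, ∀ e, L e = Y i e x := by
    intro i x hx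
    have hi := Metric.mem_ball_self (x := (i : Plane)) (hr i)
    have hu := huniq _ (hrU i) Metric.isOpen_ball (convex_ball _ _)
    let L : E →ₗ[ℝ] E :=
      { toFun := fun e => Y i e x
        map_add' := fun e e' => hu _ _ (hY i _) ((hY i e).add (hY i e')) _ hi
          (by simp [hY0]) _ hx
        map_smul' := fun c e => hu _ _ (hY i _) ((hY i e).const_smul c) _ hi
          (by simp [hY0]) _ hx }
    have hinj : Function.Injective L := fun e e' h => by
      have := hu _ _ (hY i e) (hY i e') _ hx h _ hi
      rwa [hY0, hY0] at this
    exact ⟨(LinearEquiv.ofInjectiveEndo L hinj).toEquiv, fun e => rfl⟩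
  have hΦ : ∀ i x : U, ∃ L : E ≃ E,
      (x : Plane) ∈ Metric.ball (i : Plane) (r i) → ∀ e, L e = Y i e x := fun i x => by
    by_cases hx : (x : Plane) ∈ Metric.ball (i : Plane) (r i)
    · exact (hlin i x hx).imp fun L hL _ => hL
    · exact ⟨Equiv.refl E, fun h => absurd h hx⟩
  choose Φ hΦ using hΦ
  obtain ⟨s, hs0, hs⟩ := exists_global_section (X := U) (F := E)
    (fun i => Subtype.val ⁻¹' Metric.ball (i : Plane) (r i))
    (fun i => Metric.isOpen_ball.preimage continuous_subtype_val)
    (fun i => Metric.mem_ball_self (hr i)) Φ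
    -- The overlap of two balls is convex, hence connected, so parallel sections agreeing at `y`
    -- agree at `x`: transition functions are constant.
    (fun i j x hx y hy v => by
      rw [Equiv.symm_apply_eq, hΦ j x hx.2]
      have h := huniq (Metric.ball (i : Plane) (r i) ∩ Metric.ball (j : Plane) (r j))
        (inter_subset_left.trans (hrU i)) (Metric.isOpen_ball.inter Metric.isOpen_ball)
        ((convex_ball _ _).inter (convex_ball _ _)) (Y i v) (Y j ((Φ j y).symm (Φ i y v)))
        ((hY i v).mono inter_subset_left) ((hY j _).mono inter_subset_right) y hy
        (by rw [← hΦ j y hy.2, ← hΦ i y hy.1, Equiv.apply_symm_apply]) x hx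
      rw [hΦ i x hx.1, h]) ⟨p₀, hp₀⟩ e
  classical
  refine ⟨fun p => if h : p ∈ U then s ⟨p, h⟩ else 0, by simp [hp₀, hs0], fun p hp => ?_⟩
  obtain ⟨v, hv⟩ := hs ⟨p, hp⟩
  have heq : (fun p => if h : p ∈ U then s ⟨p, h⟩ else 0) =ᶠ[𝓝 p] Y ⟨p, hp⟩ v := by
    have hv' : ∀ᶠ q in 𝓝 p, ∀ hq : q ∈ U, s ⟨q, hq⟩ = Φ ⟨p, hp⟩ ⟨q, hq⟩ v := by
      rw [nhds_subtype_eq_comap, eventually_comap] at hv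
      filter_upwards [hv] with q hq hqU using hq ⟨q, hqU⟩ rfl
    filter_upwards [hv', U.isOpen.mem_nhds hp, Metric.ball_mem_nhds p (hr ⟨p, hp⟩)] with q h1 h2 h3
    rw [dif_pos (show q ∈ U from h2), h1 h2, hΦ _ _ h3]
  have := (hY ⟨p, hp⟩ v p (Metric.mem_ball_self (hr _))).congr_of_eventuallyEq heq
  rwa [← heq.eq_of_nhds] at this

end GlobalParallel

/-! ### Calculus of one-forms on the plane -/

section Forms

theorem plane_eq (v : Plane) : v = v.1 • ((1, 0) : Plane) + v.2 • ((0, 1) : Plane) := by simp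

theorem apply_plane (α : Plane →L[ℝ] ℝ) (v : Plane) : α v = v.1 * α (1, 0) + v.2 * α (0, 1) := by
  conv_lhs => rw [plane_eq v]
  rw [map_add, map_smul, map_smul, smul_eq_mul, smul_eq_mul]

theorem smooth_differentiableAt {F : Type*} [NormedAddCommGroup F] [NormedSpace ℝ F]
    {U : Opens Plane} {f : Plane → F} (hf : ContDiffOn ℝ ∞ f U) {p : Plane} (hp : p ∈ U) :
    DifferentiableAt ℝ f p :=
  (hf.contDiffAt (U.isOpen.mem_nhds hp)).differentiableAt (by simp)

theorem smooth_fderiv {F : Type*} [NormedAddCommGroup F] [NormedSpace ℝ F]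
    {U : Opens Plane} {f : Plane → F} (hf : ContDiffOn ℝ ∞ f U) :
    ContDiffOn ℝ ∞ (fderiv ℝ f) U :=
  hf.fderiv_of_isOpen U.isOpen (by simp)

theorem smooth_extD {U : Opens Plane} {α : OneForm} (hα : ContDiffOn ℝ ∞ α U)
    {X Y : Plane → Plane} (hX : ContDiffOn ℝ ∞ X U) (hY : ContDiffOn ℝ ∞ Y U) :
    ContDiffOn ℝ ∞ (fun p => extD α p ![X p, Y p]) U :=
  ((((smooth_fderiv hα).clm_apply hX).clm_apply hY).sub
    (((smooth_fderiv hα).clm_apply hY).clm_apply hX)).congr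
      fun _ hp => extD_apply (smooth_differentiableAt hα hp) _ _

theorem eventuallyEq_of_eqOn {F : Type*} {U : Opens Plane} {f g : Plane → F}
    (h : ∀ p ∈ U, f p = g p) {p : Plane} (hp : p ∈ U) : f =ᶠ[𝓝 p] g := by
  filter_upwards [U.isOpen.mem_nhds hp] with q hq using h q hq

theorem extD_congr {U : Opens Plane} {α β : OneForm} (h : ∀ p ∈ U, α p = β p) {p : Plane}
    (hp : p ∈ U) (hα : DifferentiableAt ℝ α p) (v w : Plane) :
    extD α p ![v, w] = extD β p ![v, w] := by
  have he := eventuallyEq_of_eqOn h hp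
  rw [extD_apply hα, extD_apply (hα.congr_of_eventuallyEq he.symm), he.fderiv_eq]

theorem fderiv_apply_vectorField {α : OneForm} {Y : Plane → Plane} {p : Plane}
    (hα : DifferentiableAt ℝ α p) (hY : DifferentiableAt ℝ Y p) (v : Plane) :
    fderiv ℝ (fun q => α q (Y q)) p v = fderiv ℝ α p v (Y p) + α p (fderiv ℝ Y p v) := by
  rw [fderiv_clm_apply hα hY]
  simp [add_comm]

/-- Cartan's formula for the exterior derivative of a `1`-form. -/
theorem extD_vectorFields {α : OneForm} {X Y : Plane → Plane} {p : Plane}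
    (hα : DifferentiableAt ℝ α p) (hX : DifferentiableAt ℝ X p) (hY : DifferentiableAt ℝ Y p) :
    extD α p ![X p, Y p] = fderiv ℝ (fun q => α q (Y q)) p (X p)
      - fderiv ℝ (fun q => α q (X q)) p (Y p)
      - α p (fderiv ℝ Y p (X p) - fderiv ℝ X p (Y p)) := by
  rw [fderiv_apply_vectorField hα hY, fderiv_apply_vectorField hα hX, extD_apply hα, map_sub]
  ring

theorem extD_fderiv {U : Opens Plane} {f : Plane → ℝ} (hf : ContDiffOn ℝ ∞ f U) {p : Plane}
    (hp : p ∈ U) (v w : Plane) : extD (fderiv ℝ f) p ![v, w] = 0 := by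
  rw [extD_apply (smooth_differentiableAt (smooth_fderiv hf) hp), sub_eq_zero]
  exact ((hf.contDiffAt (U.isOpen.mem_nhds hp)).isSymmSndFDerivAt (by
    simpa [minSmoothness_of_isRCLikeNormedField] using
      WithTop.coe_le_coe.2 (le_top : (2 : ℕ∞) ≤ ⊤))) v w

theorem extD_smul {f : Plane → ℝ} {α : OneForm} {p : Plane} (hf : DifferentiableAt ℝ f p)
    (hα : DifferentiableAt ℝ α p) (v w : Plane) :
    extD (fun q => f q • α q) p ![v, w] =
      fderiv ℝ f p v * α p w - fderiv ℝ f p w * α p v + f p * extD α p ![v, w] := by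
  rw [extD_apply (hf.fun_smul hα), extD_apply hα, fderiv_fun_smul hf hα]
  simp
  ring

end Forms

/-! ### Frame, structure equations and covariant derivatives -/

namespace Normalization

variable {U : Opens Plane} {W : PlanarWeb 4 U} (N : Normalization W)

theorem smooth_coframe (i : Fin 4) : ContDiffOn ℝ ∞ (N.coframe i) U :=
  (N.smooth_scale i).smul (W.smooth i)

variable {p : Plane}

/-- If the determinant vanished, evaluation on each basis vector would give a linear relation
between the two forms; independence would then force their values on both basis vectors to vanish.
-/
theorem det_ne_zero (hp : p ∈ U) : N.det p ≠ 0 := by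
  intro h
  have hli := LinearIndependent.pair_iff.1 (W.transversal 0 1 (by decide) p hp)
  have h0 := N.scale_ne_zero 0 p hp
  have h1 := N.scale_ne_zero 1 p hp
  have hD : W.form 0 p (1, 0) * W.form 1 p (0, 1) - W.form 0 p (0, 1) * W.form 1 p (1, 0) = 0 := by
    have : N.scale 0 p * N.scale 1 p * (W.form 0 p (1, 0) * W.form 1 p (0, 1)
        - W.form 0 p (0, 1) * W.form 1 p (1, 0)) = 0 := by
      simp only [det, coframe, smul_apply, smul_eq_mul] at h
      linear_combination h
    simpa [h0, h1] using this
  have key : ∀ α β : Plane →L[ℝ] ℝ, α (1, 0) = β (1, 0) → α (0, 1) = β (0, 1) → α = β := by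
    intro α β h1 h2
    ext <;> simpa
  have e1 := hli (W.form 1 p (1, 0)) (-W.form 0 p (1, 0)) (key _ _ (by simp; ring)
    (by simp; linarith))
  have e2 := hli (W.form 1 p (0, 1)) (-W.form 0 p (0, 1)) (key _ _ (by simp; linarith)
    (by simp; ring))
  have e3 := hli 1 0 (key _ _ (by simpa using e1.2) (by simpa using e2.2))
  exact one_ne_zero e3.1

theorem smooth_coframe_apply (i : Fin 4) (v : Plane) : ContDiffOn ℝ ∞ (fun p => N.coframe i p v) U :=
  (N.smooth_coframe i).clm_apply contDiffOn_const

theorem smooth_det : ContDiffOn ℝ ∞ N.det U :=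
  ((N.smooth_coframe_apply 0 _).mul (N.smooth_coframe_apply 1 _)).sub
    ((N.smooth_coframe_apply 0 _).mul (N.smooth_coframe_apply 1 _))

theorem smooth_e₁ : ContDiffOn ℝ ∞ N.e₁ U :=
  (N.smooth_det.inv fun _ hp => N.det_ne_zero hp).smul
    ((N.smooth_coframe_apply 1 _).prodMk (N.smooth_coframe_apply 1 _).neg)

theorem smooth_e₂ : ContDiffOn ℝ ∞ N.e₂ U :=
  (N.smooth_det.inv fun _ hp => N.det_ne_zero hp).smul
    ((N.smooth_coframe_apply 0 _).neg.prodMk (N.smooth_coframe_apply 0 _))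

theorem coframe_zero_e₁ (hp : p ∈ U) : N.coframe 0 p (N.e₁ p) = 1 := by
  rw [e₁, map_smul, apply_plane, smul_eq_mul, inv_mul_eq_one₀ (N.det_ne_zero hp), det]
  ring

theorem coframe_zero_e₂ : N.coframe 0 p (N.e₂ p) = 0 := by
  rw [e₂, map_smul, apply_plane, smul_eq_mul]
  ring

theorem coframe_one_e₁ : N.coframe 1 p (N.e₁ p) = 0 := by
  rw [e₁, map_smul, apply_plane, smul_eq_mul]
  ring

theorem coframe_one_e₂ (hp : p ∈ U) : N.coframe 1 p (N.e₂ p) = 1 := by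
  rw [e₂, map_smul, apply_plane, smul_eq_mul, inv_mul_eq_one₀ (N.det_ne_zero hp), det]
  ring

theorem frame_decomp (hp : p ∈ U) (v : Plane) :
    v = N.coframe 0 p v • N.e₁ p + N.coframe 1 p v • N.e₂ p := by
  have hD := N.det_ne_zero hp
  rw [apply_plane (N.coframe 0 p), apply_plane (N.coframe 1 p)]
  simp only [e₁, e₂]
  refine Prod.ext ?_ ?_
  · simp only [Prod.fst_add, Prod.smul_fst, smul_eq_mul]
    field_simp
    rw [det]; ring
  · simp only [Prod.snd_add, Prod.smul_snd, smul_eq_mul]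
    field_simp
    rw [det]; ring

theorem oneForm_ext (hp : p ∈ U) {F : Type*} [NormedAddCommGroup F] [NormedSpace ℝ F]
    {α β : Plane →L[ℝ] F} (h1 : α (N.e₁ p) = β (N.e₁ p))
    (h2 : α (N.e₂ p) = β (N.e₂ p)) : α = β := by
  refine ContinuousLinearMap.ext fun v => ?_
  rw [N.frame_decomp hp v]
  simp only [map_add, map_smul, h1, h2]

theorem coframe_two (hp : p ∈ U) : N.coframe 2 p = -(N.coframe 0 p + N.coframe 1 p) :=
  (neg_eq_of_add_eq_zero_right (N.normalized₃ p hp)).symm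

theorem coframe_three (hp : p ∈ U) : N.coframe 3 p = -(N.a p • N.coframe 0 p + N.coframe 1 p) :=
  (neg_eq_of_add_eq_zero_right (N.normalized₄ p hp)).symm

theorem a_eq (hp : p ∈ U) : N.a p = -N.coframe 3 p (N.e₁ p) := by
  rw [N.coframe_three hp]
  simp [N.coframe_zero_e₁ hp, N.coframe_one_e₁]

theorem smooth_a : ContDiffOn ℝ ∞ N.a U :=
  ((N.smooth_coframe 3).clm_apply N.smooth_e₁).neg.congr fun _ hp => N.a_eq hp

theorem coframe_ne (i j : Fin 4) (hij : i ≠ j) (hp : p ∈ U) : N.coframe i p ≠ N.coframe j p := by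
  intro h
  have := LinearIndependent.pair_iff.1 (W.transversal i j hij p hp) (N.scale i p) (-N.scale j p)
    (by simpa [coframe, ← sub_eq_add_neg, sub_eq_zero] using h)
  exact N.scale_ne_zero i p hp this.1

theorem a_ne_one (hp : p ∈ U) : N.a p ≠ 1 := fun h =>
  N.coframe_ne 2 3 (by decide) hp (by rw [N.coframe_two hp, N.coframe_three hp, h, one_smul])

theorem a_ne_zero (hp : p ∈ U) : N.a p ≠ 0 := fun h => by
  have h3 := N.coframe_three hp
  rw [h, zero_smul, zero_add] at h3
  have := LinearIndependent.pair_iff.1 (W.transversal 3 1 (by decide) p hp) (N.scale 3 p)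
    (N.scale 1 p) (by change N.coframe 3 p + N.coframe 1 p = 0; rw [h3]; simp)
  exact N.scale_ne_zero 3 p hp this.1

theorem smooth_γ : ContDiffOn ℝ ∞ N.γ U :=
  ((smooth_extD (N.smooth_coframe 1) N.smooth_e₁ N.smooth_e₂).neg.smul (N.smooth_coframe 0)).add
    ((smooth_extD (N.smooth_coframe 0) N.smooth_e₁ N.smooth_e₂).smul (N.smooth_coframe 1))

theorem smooth_K : ContDiffOn ℝ ∞ N.K U := smooth_extD N.smooth_γ N.smooth_e₁ N.smooth_e₂

/-- The first component of the connection form. -/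
noncomputable def γ₁ (p : Plane) : ℝ := N.γ p (N.e₁ p)

/-- The second component of the connection form. -/
noncomputable def γ₂ (p : Plane) : ℝ := N.γ p (N.e₂ p)

theorem smooth_γ₁ : ContDiffOn ℝ ∞ N.γ₁ U := N.smooth_γ.clm_apply N.smooth_e₁
theorem smooth_γ₂ : ContDiffOn ℝ ∞ N.γ₂ U := N.smooth_γ.clm_apply N.smooth_e₂

theorem extD_coframe_zero (hp : p ∈ U) : extD (N.coframe 0) p ![N.e₁ p, N.e₂ p] = N.γ₂ p := by
  simp [γ₂, γ, N.coframe_zero_e₂, N.coframe_one_e₂ hp]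

theorem extD_coframe_one (hp : p ∈ U) : extD (N.coframe 1) p ![N.e₁ p, N.e₂ p] = -N.γ₁ p := by
  simp [γ₁, γ, N.coframe_zero_e₁ hp, N.coframe_one_e₁]

theorem fderiv_eq_zero_of_const {f : Plane → ℝ} {c : ℝ} (h : ∀ p ∈ U, f p = c) (hp : p ∈ U) :
    fderiv ℝ f p = 0 := by
  rw [(eventuallyEq_of_eqOn (g := fun _ => c) h hp).fderiv_eq]
  simp

/-- Cartan's formula for the dual coframe: the functions `ωᵢ(∂ⱼ)` are constant, so `dωᵢ(∂₁, ∂₂) =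
-ωᵢ([∂₁, ∂₂])`. -/
theorem bracket (hp : p ∈ U) :
    fderiv ℝ N.e₂ p (N.e₁ p) - fderiv ℝ N.e₁ p (N.e₂ p) = -N.γ₂ p • N.e₁ p + N.γ₁ p • N.e₂ p := by
  have hd1 := smooth_differentiableAt N.smooth_e₁ hp
  have hd2 := smooth_differentiableAt N.smooth_e₂ hp
  have h0 := extD_vectorFields (smooth_differentiableAt (N.smooth_coframe 0) hp) hd1 hd2
  have h1 := extD_vectorFields (smooth_differentiableAt (N.smooth_coframe 1) hp) hd1 hd2
  rw [N.extD_coframe_zero hp, fderiv_eq_zero_of_const (fun _ _ => N.coframe_zero_e₂) hp,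
    fderiv_eq_zero_of_const (fun _ h => N.coframe_zero_e₁ h) hp] at h0
  rw [N.extD_coframe_one hp, fderiv_eq_zero_of_const (fun _ h => N.coframe_one_e₂ h) hp,
    fderiv_eq_zero_of_const (fun _ _ => N.coframe_one_e₁) hp] at h1
  simp only [zero_apply, sub_zero, zero_sub] at h0 h1
  rw [N.frame_decomp hp (fderiv ℝ N.e₂ p (N.e₁ p) - fderiv ℝ N.e₁ p (N.e₂ p)), h0, neg_neg,
    ← neg_eq_iff_eq_neg.2 h1, neg_neg]

/-- The bracket term of Cartan's formula drops out, because `γ([∂₁, ∂₂]) = -γ₂γ₁ + γ₁γ₂ = 0`. -/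
theorem K_eq (hp : p ∈ U) : N.K p = fderiv ℝ N.γ₂ p (N.e₁ p) - fderiv ℝ N.γ₁ p (N.e₂ p) := by
  rw [K, extD_vectorFields (smooth_differentiableAt N.smooth_γ hp)
    (smooth_differentiableAt N.smooth_e₁ hp) (smooth_differentiableAt N.smooth_e₂ hp), N.bracket hp]
  simp only [map_add, map_smul, smul_eq_mul]
  change fderiv ℝ N.γ₂ p (N.e₁ p) - fderiv ℝ N.γ₁ p (N.e₂ p)
    - (-N.γ₂ p * N.γ₁ p + N.γ₁ p * N.γ₂ p) = _
  ring

/-- Cartan's formula for the closed form `df`, with the bracket expanded in the frame. -/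
theorem fderiv_commutator {f : Plane → ℝ} (hf : ContDiffOn ℝ ∞ f U) (hp : p ∈ U) :
    fderiv ℝ (fun q => fderiv ℝ f q (N.e₂ q)) p (N.e₁ p)
      - fderiv ℝ (fun q => fderiv ℝ f q (N.e₁ q)) p (N.e₂ p)
      = -N.γ₂ p * fderiv ℝ f p (N.e₁ p) + N.γ₁ p * fderiv ℝ f p (N.e₂ p) := by
  have h := extD_vectorFields (smooth_differentiableAt (smooth_fderiv hf) hp)
    (smooth_differentiableAt N.smooth_e₁ hp) (smooth_differentiableAt N.smooth_e₂ hp)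
  rw [extD_fderiv hf hp, N.bracket hp, map_add, map_smul, map_smul, smul_eq_mul, smul_eq_mul] at h
  linarith

variable {f g : Plane → ℝ}

theorem δ_e₁ (w : ℝ) (f : Plane → ℝ) (p : Plane) :
    N.δ w N.e₁ f p = fderiv ℝ f p (N.e₁ p) - w * N.γ₁ p * f p := rfl

theorem δ_e₂ (w : ℝ) (f : Plane → ℝ) (p : Plane) :
    N.δ w N.e₂ f p = fderiv ℝ f p (N.e₂ p) - w * N.γ₂ p * f p := rfl

theorem δ_e₃ (w : ℝ) (f : Plane → ℝ) (p : Plane) :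
    N.δ w N.e₃ f p = N.δ w N.e₂ f p - N.δ w N.e₁ f p := by
  simp only [δ, e₃, map_sub]
  ring

theorem δ_e₄ (w : ℝ) (f : Plane → ℝ) (p : Plane) :
    N.δ w N.e₄ f p = N.a p * N.δ w N.e₂ f p - N.δ w N.e₁ f p := by
  simp only [δ, e₄, map_sub, map_smul, smul_eq_mul]
  ring

theorem smooth_δ (w : ℝ) {X : Plane → Plane} (hX : ContDiffOn ℝ ∞ X U) (hf : ContDiffOn ℝ ∞ f U) :
    ContDiffOn ℝ ∞ (N.δ w X f) U :=
  ((smooth_fderiv hf).clm_apply hX).sub ((contDiffOn_const.mul (N.smooth_γ.clm_apply hX)).mul hf)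

theorem δ_congr (w : ℝ) (X : Plane → Plane) (h : ∀ p ∈ U, f p = g p) (hp : p ∈ U) :
    N.δ w X f p = N.δ w X g p := by
  simp only [δ, (eventuallyEq_of_eqOn h hp).fderiv_eq, h p hp]

theorem δ_add (w : ℝ) (X : Plane → Plane) (hf : ContDiffOn ℝ ∞ f U) (hg : ContDiffOn ℝ ∞ g U)
    (hp : p ∈ U) : N.δ w X (fun q => f q + g q) p = N.δ w X f p + N.δ w X g p := by
  simp only [δ, fderiv_fun_add (smooth_differentiableAt hf hp) (smooth_differentiableAt hg hp),
    add_apply]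
  ring

theorem δ_sub (w : ℝ) (X : Plane → Plane) (hf : ContDiffOn ℝ ∞ f U) (hg : ContDiffOn ℝ ∞ g U)
    (hp : p ∈ U) : N.δ w X (fun q => f q - g q) p = N.δ w X f p - N.δ w X g p := by
  simp only [δ, fderiv_fun_sub (smooth_differentiableAt hf hp) (smooth_differentiableAt hg hp),
    sub_apply]
  ring

theorem δ_neg (w : ℝ) (X : Plane → Plane) :
    N.δ w X (fun q => -f q) p = -N.δ w X f p := by
  simp only [δ, fderiv_fun_neg, neg_apply]
  ring

theorem δ_zero_const (X : Plane → Plane) (c : ℝ) : N.δ 0 X (fun _ => c) p = 0 := by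
  simp [δ]

/-- The Leibniz rule for covariant derivatives. -/
theorem δ_mul {w w' : ℝ} (v : ℝ) (hv : v = w + w') (X : Plane → Plane) (hf : ContDiffOn ℝ ∞ f U)
    (hg : ContDiffOn ℝ ∞ g U) (hp : p ∈ U) :
    N.δ v X (fun q => f q * g q) p = N.δ w X f p * g p + f p * N.δ w' X g p := by
  simp only [δ, fderiv_fun_mul (smooth_differentiableAt hf hp) (smooth_differentiableAt hg hp),
    add_apply, smul_apply, smul_eq_mul, hv]
  ring

/-- The Ricci identity: covariant derivatives of a function of weight `w` commute up to
curvature. -/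
theorem δ_commutator (w w' : ℝ) (hw : w' = w + 1) (hf : ContDiffOn ℝ ∞ f U) (hp : p ∈ U) :
    N.δ w' N.e₁ (N.δ w N.e₂ f) p - N.δ w' N.e₂ (N.δ w N.e₁ f) p = -w * N.K p * f p := by
  have hf' := smooth_differentiableAt hf hp
  have key : ∀ (X : Plane → Plane) (g : Plane → ℝ), ContDiffOn ℝ ∞ X U → ContDiffOn ℝ ∞ g U →
      ∀ v, fderiv ℝ (fun q => fderiv ℝ f q (X q) - w * g q * f q) p v =
        fderiv ℝ (fun q => fderiv ℝ f q (X q)) p v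
          - w * (fderiv ℝ g p v * f p + g p * fderiv ℝ f p v) := by
    intro X g hX hg v
    have hg' := smooth_differentiableAt hg hp
    rw [fderiv_fun_sub (smooth_differentiableAt ((smooth_fderiv hf).clm_apply hX) hp)
      ((hg'.const_mul w).fun_mul hf'), fderiv_fun_mul (hg'.const_mul w) hf', fderiv_const_mul hg']
    simp
    ring
  have h1 : fderiv ℝ (N.δ w N.e₂ f) p (N.e₁ p) = _ := key N.e₂ N.γ₂ N.smooth_e₂ N.smooth_γ₂ (N.e₁ p)
  have h2 : fderiv ℝ (N.δ w N.e₁ f) p (N.e₂ p) = _ := key N.e₁ N.γ₁ N.smooth_e₁ N.smooth_γ₁ (N.e₂ p)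
  rw [δ_e₁, δ_e₂ N w', h1, h2, δ_e₁, δ_e₂, N.K_eq hp, hw]
  linear_combination N.fderiv_commutator hf hp

end Normalization

/-! ### Coefficients of the closed system and integrability conditions -/

namespace Normalization

variable {U : Opens Plane} {W : PlanarWeb 4 U} (N : Normalization W) {p : Plane}

theorem a_sub_one_ne_zero (hp : p ∈ U) : N.a p - 1 ≠ 0 := sub_ne_zero.2 (N.a_ne_one hp)

theorem smooth_a₁ : ContDiffOn ℝ ∞ N.a₁ U := N.smooth_δ 0 N.smooth_e₁ N.smooth_a
theorem smooth_a₂ : ContDiffOn ℝ ∞ N.a₂ U := N.smooth_δ 0 N.smooth_e₂ N.smooth_a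
theorem smooth_a₁₂ : ContDiffOn ℝ ∞ N.a₁₂ U := N.smooth_δ 1 N.smooth_e₁ N.smooth_a₂

theorem a₁₂_eq_a₂₁ (hp : p ∈ U) : N.a₂₁ p = N.a₁₂ p := by
  have h : N.a₁₂ p - N.a₂₁ p = -0 * N.K p * N.a p :=
    N.δ_commutator 0 1 (by norm_num) N.smooth_a hp
  linarith

/-- The Ricci identity for `a₁`, of weight one, shows that only one of the three orderings differs
from the other two, by `K a₁`; averaging leaves a third of it. -/
theorem a₁₁₂_eq (hp : p ∈ U) :
    N.a₁₁₂ p = N.δ 2 N.e₁ N.a₁₂ p + N.K p * N.a₁ p / 3 := by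
  have h1 := N.δ_congr 2 N.e₁ (fun _ h => N.a₁₂_eq_a₂₁ h) hp
  have h2 : N.δ 2 N.e₁ N.a₂₁ p - N.δ 2 N.e₂ N.a₁₁ p = -1 * N.K p * N.a₁ p :=
    N.δ_commutator 1 2 (by norm_num) N.smooth_a₁ hp
  rw [a₁₁₂]
  linarith

theorem a₁₂₂_eq (hp : p ∈ U) :
    N.a₁₂₂ p = N.δ 2 N.e₂ N.a₁₂ p - N.K p * N.a₂ p / 3 := by
  have h1 := N.δ_congr 2 N.e₂ (fun _ h => N.a₁₂_eq_a₂₁ h) hp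
  have h2 : N.δ 2 N.e₁ N.a₂₂ p - N.δ 2 N.e₂ N.a₁₂ p = -1 * N.K p * N.a₂ p :=
    N.δ_commutator 1 2 (by norm_num) N.smooth_a₂ hp
  rw [a₁₂₂]
  linarith

/-! The abelian equation amounts to the first order linear system `δ₁u = δ₂u = w`, `δ₁v = -w`,
`δ₂v = -(w + a₂v) / a`, `δ₁w = P u + Q v + R w`, `δ₂w = (P + K) u + Q v + R w` for `u = λ₃`,
`v = λ₄`, where `P`, `Q`, `R` are the functions `coeffU`, `coeffV`, `coeffW`. -/

/-- The coefficient of `u` in `δ₁ w`. -/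
noncomputable def coeffU (p : Plane) : ℝ := -(N.a p * N.K p) / (N.a p - 1)

/-- The coefficient of `v` in `δ₁ w`. -/
noncomputable def coeffV (p : Plane) : ℝ :=
  (N.a p * N.a₁₂ p - N.a₁ p * N.a₂ p - N.a p * (N.a p * N.K p)) / (N.a p * (N.a p - 1))

/-- The coefficient of `w` in `δ₁ w`. -/
noncomputable def coeffW (p : Plane) : ℝ :=
  -(N.a p * N.a₂ p + N.a₁ p) / (N.a p * (N.a p - 1))

theorem smooth_a_sub_one : ContDiffOn ℝ ∞ (fun p => N.a p - 1) U := N.smooth_a.sub contDiffOn_const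

theorem smooth_a_mul_K : ContDiffOn ℝ ∞ (fun p => N.a p * N.K p) U := N.smooth_a.mul N.smooth_K

theorem smooth_coeffU : ContDiffOn ℝ ∞ N.coeffU U :=
  N.smooth_a_mul_K.neg.div N.smooth_a_sub_one fun _ hp => N.a_sub_one_ne_zero hp

theorem smooth_a_mul_a_sub_one : ContDiffOn ℝ ∞ (fun p => N.a p * (N.a p - 1)) U :=
  N.smooth_a.mul N.smooth_a_sub_one

theorem a_mul_a_sub_one_ne_zero (hp : p ∈ U) : N.a p * (N.a p - 1) ≠ 0 :=
  mul_ne_zero (N.a_ne_zero hp) (N.a_sub_one_ne_zero hp)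

theorem smooth_coeffV : ContDiffOn ℝ ∞ N.coeffV U :=
  (((N.smooth_a.mul N.smooth_a₁₂).sub (N.smooth_a₁.mul N.smooth_a₂)).sub
    (N.smooth_a.mul N.smooth_a_mul_K)).div N.smooth_a_mul_a_sub_one
      fun _ hp => N.a_mul_a_sub_one_ne_zero hp

theorem smooth_coeffW : ContDiffOn ℝ ∞ N.coeffW U :=
  ((N.smooth_a.mul N.smooth_a₂).add N.smooth_a₁).neg.div N.smooth_a_mul_a_sub_one
      fun _ hp => N.a_mul_a_sub_one_ne_zero hp

theorem δ_a_sub_one (X : Plane → Plane) (hp : p ∈ U) :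
    N.δ 0 X (fun q => N.a q - 1) p = N.δ 0 X N.a p := by
  rw [N.δ_sub 0 X N.smooth_a contDiffOn_const hp, δ_zero_const, sub_zero]

theorem δ_a_mul_a_sub_one (X : Plane → Plane) (hp : p ∈ U) :
    N.δ 0 X (fun q => N.a q * (N.a q - 1)) p = N.δ 0 X N.a p * (2 * N.a p - 1) := by
  rw [N.δ_mul (w := 0) (w' := 0) 0 (by norm_num) X N.smooth_a N.smooth_a_sub_one hp,
    N.δ_a_sub_one X hp]
  ring

/-- The Leibniz rule applied to `(a - 1) P = -a K`, which avoids differentiating a quotient.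
`δ_coeffV` and `δ_coeffW` follow the same pattern. -/
theorem δ_coeffU (X : Plane → Plane) (hp : p ∈ U) :
    N.δ 0 X N.a p * N.coeffU p + (N.a p - 1) * N.δ 2 X N.coeffU p
      = -(N.δ 0 X N.a p * N.K p + N.a p * N.δ 2 X N.K p) := by
  have h1 := N.δ_mul (w := 0) (w' := 2) 2 (by norm_num) X N.smooth_a_sub_one N.smooth_coeffU hp
  have h2 := N.δ_mul (w := 0) (w' := 2) 2 (by norm_num) X N.smooth_a N.smooth_K hp
  have h3 := N.δ_congr 2 X (f := fun q => (N.a q - 1) * N.coeffU q)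
    (g := fun q => -(N.a q * N.K q)) (fun q hq => by
      rw [coeffU, mul_div_cancel₀ _ (N.a_sub_one_ne_zero hq)]) hp
  rw [h1, N.δ_neg, h2, N.δ_a_sub_one X hp] at h3
  exact h3

theorem δ_coeffV (X : Plane → Plane) (hp : p ∈ U) :
    N.δ 0 X N.a p * (2 * N.a p - 1) * N.coeffV p + N.a p * (N.a p - 1) * N.δ 2 X N.coeffV p
      = N.δ 0 X N.a p * N.a₁₂ p + N.a p * N.δ 2 X N.a₁₂ p
        - (N.δ 1 X N.a₁ p * N.a₂ p + N.a₁ p * N.δ 1 X N.a₂ p)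
        - (2 * N.a p * N.δ 0 X N.a p * N.K p + N.a p ^ 2 * N.δ 2 X N.K p) := by
  have h1 := N.δ_mul (w := 0) (w' := 2) 2 (by norm_num) X N.smooth_a_mul_a_sub_one
    N.smooth_coeffV hp
  have h2 := N.δ_mul (w := 0) (w' := 2) 2 (by norm_num) X N.smooth_a N.smooth_K hp
  have h3 := N.δ_congr 2 X (f := fun q => N.a q * (N.a q - 1) * N.coeffV q)
    (g := fun q => N.a q * N.a₁₂ q - N.a₁ q * N.a₂ q - N.a q * (N.a q * N.K q)) (fun q hq => by
      rw [coeffV, mul_div_cancel₀ _ (N.a_mul_a_sub_one_ne_zero hq)]) hp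
  rw [h1, N.δ_a_mul_a_sub_one X hp,
    N.δ_sub 2 X ((N.smooth_a.mul N.smooth_a₁₂).sub (N.smooth_a₁.mul N.smooth_a₂))
      (N.smooth_a.mul N.smooth_a_mul_K) hp,
    N.δ_sub 2 X (N.smooth_a.mul N.smooth_a₁₂) (N.smooth_a₁.mul N.smooth_a₂) hp,
    N.δ_mul (w := 0) (w' := 2) 2 (by norm_num) X N.smooth_a N.smooth_a₁₂ hp,
    N.δ_mul (w := 1) (w' := 1) 2 (by norm_num) X N.smooth_a₁ N.smooth_a₂ hp,
    N.δ_mul (w := 0) (w' := 2) 2 (by norm_num) X N.smooth_a N.smooth_a_mul_K hp, h2] at h3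
  rw [h3]
  ring

theorem δ_coeffW (X : Plane → Plane) (hp : p ∈ U) :
    N.δ 0 X N.a p * (2 * N.a p - 1) * N.coeffW p + N.a p * (N.a p - 1) * N.δ 1 X N.coeffW p
      = -(N.δ 0 X N.a p * N.a₂ p + N.a p * N.δ 1 X N.a₂ p + N.δ 1 X N.a₁ p) := by
  have h1 := N.δ_mul (w := 0) (w' := 1) 1 (by norm_num) X N.smooth_a_mul_a_sub_one
    N.smooth_coeffW hp
  have h3 := N.δ_congr 1 X (f := fun q => N.a q * (N.a q - 1) * N.coeffW q)
    (g := fun q => -(N.a q * N.a₂ q + N.a₁ q)) (fun q hq => by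
      rw [coeffW, mul_div_cancel₀ _ (N.a_mul_a_sub_one_ne_zero hq)]) hp
  rw [h1, N.δ_a_mul_a_sub_one X hp, N.δ_neg,
    N.δ_add 1 X (N.smooth_a.mul N.smooth_a₂) N.smooth_a₁ hp,
    N.δ_mul (w := 0) (w' := 1) 1 (by norm_num) X N.smooth_a N.smooth_a₂ hp] at h3
  exact h3

/-- The coefficient of `u` in the integrability condition of the system. -/
noncomputable def obstructionU (p : Plane) : ℝ :=
  N.δ 2 N.e₁ N.coeffU p + N.δ 2 N.e₁ N.K p - N.δ 2 N.e₂ N.coeffU p - N.coeffW p * N.K p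

/-- The coefficient of `v` in the integrability condition of the system. -/
noncomputable def obstructionV (p : Plane) : ℝ :=
  N.δ 2 N.e₁ N.coeffV p - N.δ 2 N.e₂ N.coeffV p + N.coeffV p * (N.a₂ p / N.a p)

/-- The coefficient of `w` in the integrability condition of the system. -/
noncomputable def obstructionW (p : Plane) : ℝ :=
  N.δ 1 N.e₁ N.coeffW p - N.δ 1 N.e₂ N.coeffW p + 3 * N.K p - N.coeffV p + N.coeffV p / N.a p

/-- The difference of the two sides of the formula for `K`. -/
noncomputable def defectK (p : Plane) : ℝ :=
  N.K p - ((-N.a₁₁ p + N.a p * N.a₂₂ p + 2 * (1 - N.a p) * N.a₁₂ p) / (4 * N.a p * (1 - N.a p))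
      + ((1 - 2 * N.a p) * N.a₁ p ^ 2 + N.a p ^ 2 * N.a₂ p ^ 2
        - 2 * (1 - N.a p) ^ 2 * N.a₁ p * N.a₂ p) / (4 * (1 - N.a p) ^ 2 * N.a p ^ 2))

/-- The difference of the two sides of the formula for `K₃`. -/
noncomputable def defectK₃ (p : Plane) : ℝ :=
  N.K₃ p - (((4 - N.a p) * N.a₁ p - (11 - 20 * N.a p + 12 * N.a p ^ 2) * N.a₂ p)
        / (3 * (1 - N.a p) * N.a p) * N.K p
      + (N.a₁₂₂ p - N.a₁₁₂ p) / N.a p + N.a₄ p * N.a₂₂ p / N.a p ^ 2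
      + (2 * N.a p - 1) * N.a₄ p * N.a₁₂ p / ((1 - N.a p) * N.a p ^ 2)
      + (2 * N.a₂ p ^ 2 * (1 - N.a p) * N.a₁ p + N.a₂ p ^ 2 * N.a₄ p)
        / ((1 - N.a p) * N.a p ^ 2))

/-- The difference of the two sides of the formula for `K₄`. -/
noncomputable def defectK₄ (p : Plane) : ℝ :=
  N.K₄ p - (N.a p * N.a₄ p - (1 - N.a p) * N.a₁ p - 2 * N.a p * N.a₃ p)
    / ((1 - N.a p) * N.a p) * N.K p

theorem formulasAt_iff_defects : N.FormulasAt p ↔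
    N.defectK p = 0 ∧ N.defectK₃ p = 0 ∧ N.defectK₄ p = 0 := by
  rw [defectK, defectK₃, defectK₄, sub_eq_zero, sub_eq_zero, sub_eq_zero]
  rfl

theorem a₃_eq : N.a₃ p = N.a₂ p - N.a₁ p := N.δ_e₃ 0 N.a p
theorem a₄_eq : N.a₄ p = N.a p * N.a₂ p - N.a₁ p := N.δ_e₄ 0 N.a p
theorem K₃_eq : N.K₃ p = N.δ 2 N.e₂ N.K p - N.δ 2 N.e₁ N.K p := N.δ_e₃ 2 N.K p
theorem K₄_eq : N.K₄ p = N.a p * N.δ 2 N.e₂ N.K p - N.δ 2 N.e₁ N.K p := N.δ_e₄ 2 N.K p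

theorem δ_coeffU_eq (X : Plane → Plane) (hp : p ∈ U) :
    N.δ 2 X N.coeffU p = (-(N.δ 0 X N.a p * N.K p + N.a p * N.δ 2 X N.K p)
      - N.δ 0 X N.a p * N.coeffU p) / (N.a p - 1) := by
  rw [eq_div_iff (N.a_sub_one_ne_zero hp)]
  linear_combination N.δ_coeffU X hp

theorem δ_coeffV_eq (X : Plane → Plane) (hp : p ∈ U) :
    N.δ 2 X N.coeffV p = (N.δ 0 X N.a p * N.a₁₂ p + N.a p * N.δ 2 X N.a₁₂ p
        - (N.δ 1 X N.a₁ p * N.a₂ p + N.a₁ p * N.δ 1 X N.a₂ p)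
        - (2 * N.a p * N.δ 0 X N.a p * N.K p + N.a p ^ 2 * N.δ 2 X N.K p)
        - N.δ 0 X N.a p * (2 * N.a p - 1) * N.coeffV p) / (N.a p * (N.a p - 1)) := by
  rw [eq_div_iff (N.a_mul_a_sub_one_ne_zero hp)]
  linear_combination N.δ_coeffV X hp

theorem δ_coeffW_eq (X : Plane → Plane) (hp : p ∈ U) :
    N.δ 1 X N.coeffW p = (-(N.δ 0 X N.a p * N.a₂ p + N.a p * N.δ 1 X N.a₂ p + N.δ 1 X N.a₁ p)
        - N.δ 0 X N.a p * (2 * N.a p - 1) * N.coeffW p) / (N.a p * (N.a p - 1)) := by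
  rw [eq_div_iff (N.a_mul_a_sub_one_ne_zero hp)]
  linear_combination N.δ_coeffW X hp

theorem one_sub_a (p : Plane) : 1 - N.a p = -(N.a p - 1) := by ring

theorem obstructionU_eq (hp : p ∈ U) : N.obstructionU p = N.defectK₄ p / (N.a p - 1) := by
  have h0 := N.a_ne_zero hp
  have h1 := N.a_sub_one_ne_zero hp
  rw [obstructionU, N.δ_coeffU_eq _ hp, N.δ_coeffU_eq _ hp, defectK₄, K₄_eq, a₃_eq, a₄_eq,
    coeffU, coeffW, one_sub_a]
  change (-(N.a₁ p * N.K p + _) - N.a₁ p * _) / _ + _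
    - (-(N.a₂ p * N.K p + _) - N.a₂ p * _) / _ - _ = _
  field_simp
  ring

theorem obstructionW_eq (hp : p ∈ U) : N.obstructionW p = 4 * N.defectK p := by
  have h0 := N.a_ne_zero hp
  have h1 := N.a_sub_one_ne_zero hp
  rw [obstructionW, N.δ_coeffW_eq _ hp, N.δ_coeffW_eq _ hp, defectK, coeffV, coeffW, one_sub_a]
  change (-(N.a₁ p * _ + _ * N.a₁₂ p + N.a₁₁ p) - N.a₁ p * _ * _) / _
    - (-(N.a₂ p * _ + _ * N.a₂₂ p + N.a₂₁ p) - N.a₂ p * _ * _) / _ + _ - _ + _ = _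
  rw [N.a₁₂_eq_a₂₁ hp]
  field_simp
  ring

/-- The only obstruction that mixes two formulas: the one for `K₃` is recovered from it after the
one for `K` is known. -/
theorem obstructionV_eq (hp : p ∈ U) : N.obstructionV p =
    N.a p / (N.a p - 1) * N.defectK₃ p + 4 * N.a₂ p * N.defectK p := by
  have h0 := N.a_ne_zero hp
  have h1 := N.a_sub_one_ne_zero hp
  rw [obstructionV, N.δ_coeffV_eq _ hp, N.δ_coeffV_eq _ hp, defectK, defectK₃, N.a₁₁₂_eq hp,
    N.a₁₂₂_eq hp, a₄_eq, K₃_eq, coeffV, one_sub_a]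
  change (N.a₁ p * _ + _ - (N.a₁₁ p * _ + _ * N.a₁₂ p) - (_ * N.a₁ p * _ + _) - N.a₁ p * _ * _) / _
    - (N.a₂ p * _ + _ - (N.a₂₁ p * _ + _ * N.a₂₂ p) - (_ * N.a₂ p * _ + _) - N.a₂ p * _ * _) / _
      + _ = _
  rw [N.a₁₂_eq_a₂₁ hp]
  field_simp
  ring

/-- The integrability conditions of the system are the three formulas. -/
theorem formulasAt_iff_obstructions (hp : p ∈ U) : N.FormulasAt p ↔
    N.obstructionU p = 0 ∧ N.obstructionV p = 0 ∧ N.obstructionW p = 0 := by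
  have h0 := N.a_ne_zero hp
  have h1 := N.a_sub_one_ne_zero hp
  rw [formulasAt_iff_defects, N.obstructionU_eq hp, N.obstructionV_eq hp, N.obstructionW_eq hp]
  constructor
  · rintro ⟨hK, h3, h4⟩
    simp [hK, h3, h4]
  -- The combination is triangular: `hK` gives the formula for `K`, which removes the second term of
  -- `h3`.
  · rintro ⟨h4, h3, hK⟩
    have hK' : N.defectK p = 0 := by simpa using hK
    rw [hK', mul_zero, add_zero] at h3
    simp only [mul_eq_zero, div_eq_zero_iff, h0, h1, or_false, false_or] at h3 h4
    exact ⟨hK', h3, h4⟩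

end Normalization

/-! ### The connection of the abelian equation and its curvature -/

namespace Normalization

variable {U : Opens Plane} {W : PlanarWeb 4 U} (N : Normalization W) {p : Plane}

/-- The component along `∂₁` of the connection of the abelian equation, in the variables
`(u, v, w)`. -/
noncomputable def conn₁ (p : Plane) : (ℝ × ℝ × ℝ) →L[ℝ] (ℝ × ℝ × ℝ) :=
  let u := ContinuousLinearMap.fst ℝ ℝ (ℝ × ℝ)
  let v := ContinuousLinearMap.fst ℝ ℝ ℝ ∘L ContinuousLinearMap.snd ℝ ℝ (ℝ × ℝ)
  let w := ContinuousLinearMap.snd ℝ ℝ ℝ ∘L ContinuousLinearMap.snd ℝ ℝ (ℝ × ℝ)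
  (N.γ₁ p • u + w).prod ((N.γ₁ p • v - w).prod
    (N.coeffU p • u + N.coeffV p • v + (N.coeffW p + 2 * N.γ₁ p) • w))

/-- The component along `∂₂` of the connection of the abelian equation, in the variables
`(u, v, w)`. -/
noncomputable def conn₂ (p : Plane) : (ℝ × ℝ × ℝ) →L[ℝ] (ℝ × ℝ × ℝ) :=
  let u := ContinuousLinearMap.fst ℝ ℝ (ℝ × ℝ)
  let v := ContinuousLinearMap.fst ℝ ℝ ℝ ∘L ContinuousLinearMap.snd ℝ ℝ (ℝ × ℝ)
  let w := ContinuousLinearMap.snd ℝ ℝ ℝ ∘L ContinuousLinearMap.snd ℝ ℝ (ℝ × ℝ)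
  (N.γ₂ p • u + w).prod (((N.γ₂ p - N.a₂ p / N.a p) • v - (N.a p)⁻¹ • w).prod
    ((N.coeffU p + N.K p) • u + N.coeffV p • v + (N.coeffW p + 2 * N.γ₂ p) • w))

theorem conn₁_apply (p : Plane) (y : ℝ × ℝ × ℝ) : N.conn₁ p y =
    (N.γ₁ p * y.1 + y.2.2, N.γ₁ p * y.2.1 - y.2.2,
      N.coeffU p * y.1 + N.coeffV p * y.2.1 + (N.coeffW p + 2 * N.γ₁ p) * y.2.2) := by
  simp [conn₁]

theorem conn₂_apply (p : Plane) (y : ℝ × ℝ × ℝ) : N.conn₂ p y =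
    (N.γ₂ p * y.1 + y.2.2, (N.γ₂ p - N.a₂ p / N.a p) * y.2.1 - (N.a p)⁻¹ * y.2.2,
      (N.coeffU p + N.K p) * y.1 + N.coeffV p * y.2.1 + (N.coeffW p + 2 * N.γ₂ p) * y.2.2) := by
  simp [conn₂]

theorem smooth_a₂_div_a : ContDiffOn ℝ ∞ (fun p => N.a₂ p / N.a p) U :=
  N.smooth_a₂.div N.smooth_a fun _ hp => N.a_ne_zero hp

theorem smooth_inv_a : ContDiffOn ℝ ∞ (fun p => (N.a p)⁻¹) U :=
  N.smooth_a.inv fun _ hp => N.a_ne_zero hp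

theorem smooth_conn₁ : ContDiffOn ℝ ∞ N.conn₁ U := by
  have := N.smooth_γ₁
  have := N.smooth_coeffU
  have := N.smooth_coeffV
  have := N.smooth_coeffW
  refine contDiffOn_clm_apply.2 fun y => ?_
  simp only [conn₁_apply]
  fun_prop

theorem smooth_conn₂ : ContDiffOn ℝ ∞ N.conn₂ U := by
  have := N.smooth_γ₂
  have := N.smooth_K
  have := N.smooth_coeffU
  have := N.smooth_coeffV
  have := N.smooth_coeffW
  have := N.smooth_a₂_div_a
  have := N.smooth_inv_a
  refine contDiffOn_clm_apply.2 fun y => ?_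
  simp only [conn₂_apply]
  fun_prop

/-- The connection on the trivial bundle of rank three whose parallel sections are the abelian
relations of the web. -/
noncomputable def conn (p : Plane) : Plane →L[ℝ] (ℝ × ℝ × ℝ) →L[ℝ] (ℝ × ℝ × ℝ) :=
  (N.coframe 0 p).smulRight (N.conn₁ p) + (N.coframe 1 p).smulRight (N.conn₂ p)

theorem conn_apply (p v : Plane) (y : ℝ × ℝ × ℝ) : N.conn p v y =
    N.coframe 0 p v • N.conn₁ p y + N.coframe 1 p v • N.conn₂ p y := rfl

theorem conn_e₁ (hp : p ∈ U) : N.conn p (N.e₁ p) = N.conn₁ p := by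
  refine ContinuousLinearMap.ext fun y => ?_
  simp [conn_apply, N.coframe_zero_e₁ hp, N.coframe_one_e₁]

theorem conn_e₂ (hp : p ∈ U) : N.conn p (N.e₂ p) = N.conn₂ p := by
  refine ContinuousLinearMap.ext fun y => ?_
  simp [conn_apply, N.coframe_zero_e₂, N.coframe_one_e₂ hp]

theorem smooth_conn : ContDiffOn ℝ ∞ N.conn U := by
  refine contDiffOn_clm_apply.2 fun v => contDiffOn_clm_apply.2 fun y => ?_
  exact ((N.smooth_coframe_apply 0 v).smul (N.smooth_conn₁.clm_apply contDiffOn_const)).add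
    ((N.smooth_coframe_apply 1 v).smul (N.smooth_conn₂.clm_apply contDiffOn_const))

theorem fderiv_conn_apply (hp : p ∈ U) (v w : Plane) (y : ℝ × ℝ × ℝ) :
    fderiv ℝ N.conn p v w y =
      fderiv ℝ (N.coframe 0) p v w • N.conn₁ p y
        + N.coframe 0 p w • fderiv ℝ (fun q => N.conn₁ q y) p v
        + (fderiv ℝ (N.coframe 1) p v w • N.conn₂ p y
        + N.coframe 1 p w • fderiv ℝ (fun q => N.conn₂ q y) p v) := by
  have hc := smooth_differentiableAt N.smooth_conn hp
  have h1 : HasFDerivAt (fun q => N.conn q w y) _ p :=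
    (hc.hasFDerivAt.clm_apply (hasFDerivAt_const w p)).clm_apply (hasFDerivAt_const y p)
  have hω : ∀ i, HasFDerivAt (fun q => N.coframe i q w) _ p := fun i =>
    (smooth_differentiableAt (N.smooth_coframe i) hp).hasFDerivAt.clm_apply (hasFDerivAt_const w p)
  have hM₁ : HasFDerivAt (fun q => N.conn₁ q y) _ p :=
    (smooth_differentiableAt (N.smooth_conn₁.clm_apply contDiffOn_const) hp).hasFDerivAt
  have hM₂ : HasFDerivAt (fun q => N.conn₂ q y) _ p :=
    (smooth_differentiableAt (N.smooth_conn₂.clm_apply contDiffOn_const) hp).hasFDerivAt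
  have h2 := ((hω 0).fun_smul hM₁).fun_add ((hω 1).fun_smul hM₂)
  have h3 := congrArg (fun L => L v) (h1.unique h2)
  simp only [add_apply, smul_apply, ContinuousLinearMap.flip_apply, ContinuousLinearMap.comp_zero, zero_add,
    ContinuousLinearMap.smulRight_apply] at h3
  rw [h3]
  abel

/-- Curvature of `ω₁ M₁ + ω₂ M₂` in the frame: the terms in `γ` come from `dω₁(∂₁, ∂₂) = γ₂` and
`dω₂(∂₁, ∂₂) = -γ₁`. -/
theorem connCurvature_apply_eq (hp : p ∈ U) (y : ℝ × ℝ × ℝ) :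
    connCurvature N.conn p (N.e₁ p) (N.e₂ p) y =
      N.γ₂ p • N.conn₁ p y - N.γ₁ p • N.conn₂ p y
        + (fderiv ℝ (fun q => N.conn₂ q y) p (N.e₁ p) - fderiv ℝ (fun q => N.conn₁ q y) p (N.e₂ p))
        + (N.conn₂ p (N.conn₁ p y) - N.conn₁ p (N.conn₂ p y)) := by
  have h0 := N.extD_coframe_zero hp
  have h1 := N.extD_coframe_one hp
  rw [extD_apply (smooth_differentiableAt (N.smooth_coframe _) hp)] at h0 h1
  rw [← h0, ← neg_eq_iff_eq_neg.2 h1]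
  simp only [connCurvature, add_apply, sub_apply, ContinuousLinearMap.comp_apply, N.conn_e₁ hp,
    N.conn_e₂ hp, N.fderiv_conn_apply hp, N.coframe_zero_e₁ hp, N.coframe_zero_e₂,
    N.coframe_one_e₁, N.coframe_one_e₂ hp, sub_smul, neg_smul, one_smul, zero_smul]
  abel

theorem fderiv_conn₁_apply (hp : p ∈ U) (y : ℝ × ℝ × ℝ) (v : Plane) :
    fderiv ℝ (fun q => N.conn₁ q y) p v =
      (fderiv ℝ N.γ₁ p v * y.1, fderiv ℝ N.γ₁ p v * y.2.1,
        fderiv ℝ N.coeffU p v * y.1 + fderiv ℝ N.coeffV p v * y.2.1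
          + (fderiv ℝ N.coeffW p v + 2 * fderiv ℝ N.γ₁ p v) * y.2.2) := by
  have hγ := (smooth_differentiableAt N.smooth_γ₁ hp).hasFDerivAt
  have hP := (smooth_differentiableAt N.smooth_coeffU hp).hasFDerivAt
  have hQ := (smooth_differentiableAt N.smooth_coeffV hp).hasFDerivAt
  have hR := (smooth_differentiableAt N.smooth_coeffW hp).hasFDerivAt
  have h := ((hγ.mul_const y.1).add_const y.2.2).prodMk
    (((hγ.mul_const y.2.1).sub_const y.2.2).prodMk
      (((hP.mul_const y.1).fun_add (hQ.mul_const y.2.1)).fun_add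
        ((hR.fun_add (hγ.const_mul 2)).mul_const y.2.2)))
  simp only [conn₁_apply]
  rw [h.fderiv]
  simp
  refine ⟨?_, ?_, ?_⟩ <;> ring

theorem fderiv_conn₂_apply (hp : p ∈ U) (y : ℝ × ℝ × ℝ) (v : Plane) :
    fderiv ℝ (fun q => N.conn₂ q y) p v =
      (fderiv ℝ N.γ₂ p v * y.1,
        (fderiv ℝ N.γ₂ p v - fderiv ℝ (fun q => N.a₂ q / N.a q) p v) * y.2.1
          - fderiv ℝ (fun q => (N.a q)⁻¹) p v * y.2.2,
        (fderiv ℝ N.coeffU p v + fderiv ℝ N.K p v) * y.1 + fderiv ℝ N.coeffV p v * y.2.1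
          + (fderiv ℝ N.coeffW p v + 2 * fderiv ℝ N.γ₂ p v) * y.2.2) := by
  have hγ := (smooth_differentiableAt N.smooth_γ₂ hp).hasFDerivAt
  have hP := (smooth_differentiableAt N.smooth_coeffU hp).hasFDerivAt
  have hQ := (smooth_differentiableAt N.smooth_coeffV hp).hasFDerivAt
  have hR := (smooth_differentiableAt N.smooth_coeffW hp).hasFDerivAt
  have hK := (smooth_differentiableAt N.smooth_K hp).hasFDerivAt
  have hq := (smooth_differentiableAt N.smooth_a₂_div_a hp).hasFDerivAt
  have hr := (smooth_differentiableAt N.smooth_inv_a hp).hasFDerivAt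
  have h := ((hγ.mul_const y.1).add_const y.2.2).prodMk
    ((((hγ.fun_sub hq).mul_const y.2.1).fun_sub (hr.mul_const y.2.2)).prodMk
      ((((hP.fun_add hK).mul_const y.1).fun_add (hQ.mul_const y.2.1)).fun_add
        ((hR.fun_add (hγ.const_mul 2)).mul_const y.2.2)))
  simp only [conn₂_apply]
  rw [h.fderiv]
  simp
  refine ⟨?_, ?_, ?_⟩ <;> ring

theorem δ_a₂_div_a (X : Plane → Plane) (hp : p ∈ U) :
    N.δ 0 X N.a p * (N.a₂ p / N.a p) + N.a p * N.δ 1 X (fun q => N.a₂ q / N.a q) p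
      = N.δ 1 X N.a₂ p := by
  rw [← N.δ_mul (w := 0) (w' := 1) 1 (by norm_num) X N.smooth_a N.smooth_a₂_div_a hp]
  exact N.δ_congr 1 X (fun q hq => mul_div_cancel₀ _ (N.a_ne_zero hq)) hp

theorem δ_inv_a (X : Plane → Plane) (hp : p ∈ U) :
    N.δ 0 X N.a p * (N.a p)⁻¹ + N.a p * N.δ 0 X (fun q => (N.a q)⁻¹) p = 0 := by
  rw [← N.δ_mul (w := 0) (w' := 0) 0 (by norm_num) X N.smooth_a N.smooth_inv_a hp]
  exact (N.δ_congr 0 X (fun q hq => mul_inv_cancel₀ (N.a_ne_zero hq)) hp).trans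
    (N.δ_zero_const X 1)

/-- The curvature of the connection of the abelian equation. -/
theorem connCurvature_conn (hp : p ∈ U) (y : ℝ × ℝ × ℝ) :
    connCurvature N.conn p (N.e₁ p) (N.e₂ p) y =
      (0, 0, N.obstructionU p * y.1 + N.obstructionV p * y.2.1 + N.obstructionW p * y.2.2) := by
  have h0 := N.a_ne_zero hp
  have h1 := N.a_sub_one_ne_zero hp
  have hK := N.K_eq hp
  rw [N.connCurvature_apply_eq hp, N.fderiv_conn₁_apply hp, N.fderiv_conn₂_apply hp]
  have hq : fderiv ℝ (fun q => N.a₂ q / N.a q) p (N.e₁ p) = (N.a₁₂ p - N.a₁ p * (N.a₂ p / N.a p))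
      / N.a p + N.γ₁ p * (N.a₂ p / N.a p) := by
    have h := N.δ_a₂_div_a N.e₁ hp
    change N.a₁ p * _ + N.a p * (fderiv ℝ (fun q => N.a₂ q / N.a q) p (N.e₁ p)
      - 1 * N.γ₁ p * (N.a₂ p / N.a p)) = N.a₁₂ p at h
    rw [← h]
    field_simp
    ring
  have hr : fderiv ℝ (fun q => (N.a q)⁻¹) p (N.e₁ p) = -(N.a₁ p * (N.a p)⁻¹) / N.a p := by
    have h := N.δ_inv_a N.e₁ hp
    change N.a₁ p * _ + N.a p * (fderiv ℝ (fun q => (N.a q)⁻¹) p (N.e₁ p)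
      - 0 * N.γ₁ p * (N.a p)⁻¹) = 0 at h
    rw [eq_div_iff h0]
    linear_combination h
  rw [hq, hr]
  simp only [conn₁_apply, conn₂_apply]
  -- The `u` and `v` components vanish identically: they express the Ricci identities for `u` and
  -- `v`, from which the coefficients were solved. Only the `w` component can survive.
  refine Prod.ext ?_ (Prod.ext ?_ ?_)
  · simp only [Prod.fst_add, Prod.fst_sub, Prod.smul_fst, smul_eq_mul]
    linear_combination -y.1 * hK
  · simp only [Prod.fst_add, Prod.fst_sub, Prod.smul_fst, Prod.snd_add, Prod.snd_sub,
      Prod.smul_snd, smul_eq_mul]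
    have hP : N.coeffU p * (N.a p - 1) = -(N.a p * N.K p) := div_mul_cancel₀ _ h1
    have hQ := div_mul_cancel₀ (N.a p * N.a₁₂ p - N.a₁ p * N.a₂ p - N.a p * (N.a p * N.K p))
      (N.a_mul_a_sub_one_ne_zero hp)
    have hR := div_mul_cancel₀ (-(N.a p * N.a₂ p + N.a₁ p)) (N.a_mul_a_sub_one_ne_zero hp)
    change N.coeffV p * _ = _ at hQ
    change N.coeffW p * _ = _ at hR
    field_simp
    linear_combination (-y.2.1 * N.a p ^ 2) * hK + y.1 * N.a p * hP + y.2.1 * hQ + y.2.2 * hR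
  · simp only [Prod.snd_add, Prod.snd_sub, Prod.smul_snd, smul_eq_mul, obstructionU,
      obstructionV, obstructionW, δ_e₁, δ_e₂]
    rw [div_eq_mul_inv (N.coeffV p)]
    linear_combination (-2 * y.2.2) * hK

end Normalization

/-- Curvature is bilinear and alternating, so in the plane one frame tests its vanishing. -/
theorem connCurvature_comb {E X : Type*} [NormedAddCommGroup E] [NormedSpace ℝ E]
    [NormedAddCommGroup X] [NormedSpace ℝ X] (Ω : X → X →L[ℝ] E →L[ℝ] E) (p x y : X)
    (a b c d : ℝ) : connCurvature Ω p (a • x + b • y) (c • x + d • y) =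
      (a * d - b * c) • connCurvature Ω p x y := by
  refine ContinuousLinearMap.ext fun e => ?_
  simp only [connCurvature, map_add, map_smul, add_apply, sub_apply, smul_apply,
    ContinuousLinearMap.comp_apply]
  module

/-! ### Abelian relations as parallel sections -/

namespace Normalization

variable {U : Opens Plane} {W : PlanarWeb 4 U} (N : Normalization W) {p : Plane} {f : Plane → ℝ}

theorem extD_eq_zero {α : OneForm} (hα : DifferentiableAt ℝ α p) (hp : p ∈ U)
    (h : extD α p ![N.e₁ p, N.e₂ p] = 0) : extD α p = 0 := by
  refine ContinuousAlternatingMap.ext fun m => ?_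
  have hm : m = ![m 0, m 1] := by
    ext i : 1
    fin_cases i <;> rfl
  change extD α p m = (0 : ℝ)
  rw [extD_apply hα] at h
  rw [hm, extD_apply hα, N.frame_decomp hp (m 0), N.frame_decomp hp (m 1)]
  simp only [map_add, map_smul, add_apply, smul_apply, smul_eq_mul]
  linear_combination (N.coframe 0 p (m 0) * N.coframe 1 p (m 1)
    - N.coframe 1 p (m 0) * N.coframe 0 p (m 1)) * h

/-- The term `f dω₁ = f ω₁ ∧ γ` completes the derivative along `∂₂` to a covariant one of weight
one; coefficients of the normalized forms therefore carry weight one. -/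
theorem extD_smul_coframe_zero (hf : ContDiffOn ℝ ∞ f U) (hp : p ∈ U) :
    extD (fun q => f q • N.coframe 0 q) p ![N.e₁ p, N.e₂ p] = -N.δ 1 N.e₂ f p := by
  rw [extD_smul (smooth_differentiableAt hf hp) (smooth_differentiableAt (N.smooth_coframe 0) hp),
    N.extD_coframe_zero hp, N.coframe_zero_e₁ hp, N.coframe_zero_e₂, δ_e₂]
  ring

theorem extD_smul_coframe_one (hf : ContDiffOn ℝ ∞ f U) (hp : p ∈ U) :
    extD (fun q => f q • N.coframe 1 q) p ![N.e₁ p, N.e₂ p] = N.δ 1 N.e₁ f p := by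
  rw [extD_smul (smooth_differentiableAt hf hp) (smooth_differentiableAt (N.smooth_coframe 1) hp),
    N.extD_coframe_one hp, N.coframe_one_e₁, N.coframe_one_e₂ hp, δ_e₁]
  ring

theorem extD_smul_coframe_comb {g h : Plane → ℝ} (hg : ContDiffOn ℝ ∞ g U)
    (hh : ContDiffOn ℝ ∞ h U) {i : Fin 4} (hf : ContDiffOn ℝ ∞ f U)
    (he : ∀ q ∈ U, f q • N.coframe i q = g q • N.coframe 0 q + h q • N.coframe 1 q) (hp : p ∈ U) :
    extD (fun q => f q • N.coframe i q) p ![N.e₁ p, N.e₂ p]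
      = N.δ 1 N.e₁ h p - N.δ 1 N.e₂ g p := by
  rw [extD_congr he hp (smooth_differentiableAt (hf.smul (N.smooth_coframe i)) hp),
    extD_add (α := fun q => g q • N.coframe 0 q) (β := fun q => h q • N.coframe 1 q)
      (smooth_differentiableAt (hg.smul (N.smooth_coframe 0)) hp)
      (smooth_differentiableAt (hh.smul (N.smooth_coframe 1)) hp),
    ContinuousAlternatingMap.add_apply, N.extD_smul_coframe_zero hg hp,
    N.extD_smul_coframe_one hh hp]
  ring

theorem extD_smul_coframe_two (hf : ContDiffOn ℝ ∞ f U) (hp : p ∈ U) :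
    extD (fun q => f q • N.coframe 2 q) p ![N.e₁ p, N.e₂ p]
      = N.δ 1 N.e₂ f p - N.δ 1 N.e₁ f p := by
  rw [N.extD_smul_coframe_comb hf.neg hf.neg hf (fun q hq => by
    rw [N.coframe_two hq]; module) hp, N.δ_neg, N.δ_neg]
  ring

theorem extD_smul_coframe_three (hf : ContDiffOn ℝ ∞ f U) (hp : p ∈ U) :
    extD (fun q => f q • N.coframe 3 q) p ![N.e₁ p, N.e₂ p]
      = N.δ 1 N.e₂ (fun q => N.a q * f q) p - N.δ 1 N.e₁ f p := by
  rw [N.extD_smul_coframe_comb (N.smooth_a.mul hf).neg hf.neg hf (fun q hq => by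
    rw [N.coframe_three hq]; module) hp, N.δ_neg, N.δ_neg]
  ring

/-- The first order linear system equivalent to the abelian equation. -/
structure IsSolution (u v w : Plane → ℝ) : Prop where
  smooth_u : ContDiffOn ℝ ∞ u U
  smooth_v : ContDiffOn ℝ ∞ v U
  smooth_w : ContDiffOn ℝ ∞ w U
  δ₁_u : ∀ p ∈ U, N.δ 1 N.e₁ u p = w p
  δ₂_u : ∀ p ∈ U, N.δ 1 N.e₂ u p = w p
  δ₁_v : ∀ p ∈ U, N.δ 1 N.e₁ v p = -w p
  δ₂_v : ∀ p ∈ U, N.a p * N.δ 1 N.e₂ v p = -(N.a₂ p * v p + w p)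

variable {u v w : Plane → ℝ} {N}

/-- Prolongation. The Ricci identity for `u` (`c1`) gives `δ₁w - δ₂w = -K u`; the one for `v`
(`c2`), after `δ₁δ₂v` is eliminated by differentiating the last equation (`c3`), prescribes `a δ₂w -
δ₁w`. Division by `a - 1` solves for both. -/
theorem IsSolution.δ_w (h : N.IsSolution u v w) (hp : p ∈ U) :
    N.δ 2 N.e₁ w p = N.coeffU p * u p + N.coeffV p * v p + N.coeffW p * w p ∧
    N.δ 2 N.e₂ w p = (N.coeffU p + N.K p) * u p + N.coeffV p * v p + N.coeffW p * w p := by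
  have h0 := N.a_ne_zero hp
  have h1 := N.a_sub_one_ne_zero hp
  have hδv := N.smooth_δ 1 N.smooth_e₂ h.smooth_v
  have c1 := N.δ_commutator 1 2 (by norm_num) h.smooth_u hp
  rw [N.δ_congr 2 N.e₁ h.δ₂_u hp, N.δ_congr 2 N.e₂ h.δ₁_u hp] at c1
  have c2 := N.δ_commutator 1 2 (by norm_num) h.smooth_v hp
  rw [N.δ_congr 2 N.e₂ h.δ₁_v hp, N.δ_neg] at c2
  have c3 := N.δ_congr 2 N.e₁ h.δ₂_v hp
  rw [N.δ_mul (w := 0) (w' := 2) 2 (by norm_num) N.e₁ N.smooth_a hδv hp, N.δ_neg,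
    N.δ_add 2 N.e₁ (N.smooth_a₂.mul h.smooth_v) h.smooth_w hp,
    N.δ_mul (w := 1) (w' := 1) 2 (by norm_num) N.e₁ N.smooth_a₂ h.smooth_v hp, h.δ₁_v p hp] at c3
  change N.a₁ p * _ + _ = -(N.a₁₂ p * _ + _ + _) at c3
  have c4 := h.δ₂_v p hp
  have key : N.δ 2 N.e₁ w p = N.coeffU p * u p + N.coeffV p * v p + N.coeffW p * w p := by
    rw [coeffU, coeffV, coeffW]
    field_simp
    linear_combination N.a p ^ 2 * c1 + N.a p ^ 2 * c2 - N.a p * c3 + N.a₁ p * c4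
  exact ⟨key, by linear_combination key - c1⟩

theorem IsSolution.isParallelOn (h : N.IsSolution u v w) :
    IsParallelOn N.conn (fun q => (u q, v q, w q)) U := by
  intro p hp
  have h0 := N.a_ne_zero hp
  have hd := ((smooth_differentiableAt h.smooth_u hp).hasFDerivAt).prodMk
    (((smooth_differentiableAt h.smooth_v hp).hasFDerivAt).prodMk
      ((smooth_differentiableAt h.smooth_w hp).hasFDerivAt))
  refine hd.congr_fderiv (N.oneForm_ext hp ?_ ?_)
  · have e1 := h.δ₁_u p hp
    have e2 := h.δ₁_v p hp
    have e3 := (h.δ_w hp).1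
    rw [δ_e₁] at e1 e2 e3
    rw [ContinuousLinearMap.flip_apply, N.conn_e₁ hp, conn₁_apply]
    refine Prod.ext ?_ (Prod.ext ?_ ?_)
    · change fderiv ℝ u p (N.e₁ p) = _
      linear_combination e1
    · change fderiv ℝ v p (N.e₁ p) = _
      linear_combination e2
    · change fderiv ℝ w p (N.e₁ p) = _
      linear_combination e3
  · have e1 := h.δ₂_u p hp
    have e2 := h.δ₂_v p hp
    have e3 := (h.δ_w hp).2
    rw [δ_e₂] at e1 e2 e3
    rw [ContinuousLinearMap.flip_apply, N.conn_e₂ hp, conn₂_apply]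
    refine Prod.ext ?_ (Prod.ext ?_ ?_)
    · change fderiv ℝ u p (N.e₂ p) = _
      linear_combination e1
    · change fderiv ℝ v p (N.e₂ p) = _
      field_simp
      linear_combination e2
    · change fderiv ℝ w p (N.e₂ p) = _
      linear_combination e3

theorem isSolution_of_isParallelOn {Y : Plane → ℝ × ℝ × ℝ} (hY : IsParallelOn N.conn Y U) :
    N.IsSolution (fun q => (Y q).1) (fun q => (Y q).2.1) (fun q => (Y q).2.2) := by
  have hs := hY.contDiffOn U.isOpen N.smooth_conn
  have hd : ∀ p ∈ U, ∀ x, fderiv ℝ (fun q => (Y q).1) p x = (N.conn p x (Y p)).1 ∧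
      fderiv ℝ (fun q => (Y q).2.1) p x = (N.conn p x (Y p)).2.1 := fun p hp x => by
    rw [(hY p hp).fst.fderiv, (hY p hp).snd.fst.fderiv]
    exact ⟨rfl, rfl⟩
  refine ⟨hs.fst, hs.snd.fst, hs.snd.snd, fun p hp => ?_, fun p hp => ?_, fun p hp => ?_,
    fun p hp => ?_⟩
  · rw [δ_e₁, (hd p hp _).1, N.conn_e₁ hp, conn₁_apply]
    ring
  · rw [δ_e₂, (hd p hp _).1, N.conn_e₂ hp, conn₂_apply]
    ring
  · rw [δ_e₁, (hd p hp _).2, N.conn_e₁ hp, conn₁_apply]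
    ring
  · have h0 := N.a_ne_zero hp
    rw [δ_e₂, (hd p hp _).2, N.conn_e₂ hp, conn₂_apply]
    field_simp
    ring

variable (N)

/-- The coefficient of an abelian relation with respect to the normalized form `coframe i`. -/
noncomputable def coeff (lam : Fin 4 → Plane → ℝ) (i : Fin 4) (p : Plane) : ℝ :=
  lam i p / N.scale i p

variable {lam : Fin 4 → Plane → ℝ}

theorem smooth_coeff (h : lam ∈ W.abelianRelations) (i : Fin 4) :
    ContDiffOn ℝ ∞ (N.coeff lam i) U :=
  (h.1 i).div (N.smooth_scale i) (N.scale_ne_zero i)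

theorem coeff_smul_coframe (lam : Fin 4 → Plane → ℝ) (i : Fin 4) (hp : p ∈ U) :
    N.coeff lam i p • N.coframe i p = lam i p • W.form i p := by
  rw [coframe, smul_smul, coeff, div_mul_cancel₀ _ (N.scale_ne_zero i p hp)]

theorem extD_coeff_smul_coframe (h : lam ∈ W.abelianRelations) (i : Fin 4) (hp : p ∈ U) :
    extD (fun q => N.coeff lam i q • N.coframe i q) p ![N.e₁ p, N.e₂ p] = 0 := by
  rw [extD_congr (fun q hq => N.coeff_smul_coframe lam i hq) hp
    (smooth_differentiableAt ((N.smooth_coeff h i).smul (N.smooth_coframe i)) hp), h.2.2.2 i p hp]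
  rfl

theorem coeff_zero_one (h : lam ∈ W.abelianRelations) (hp : p ∈ U) :
    N.coeff lam 0 p = N.coeff lam 2 p + N.a p * N.coeff lam 3 p ∧
    N.coeff lam 1 p = N.coeff lam 2 p + N.coeff lam 3 p := by
  have hs := h.2.2.1 p hp
  simp only [Fin.sum_univ_four, ← N.coeff_smul_coframe lam _ hp, N.coframe_two hp,
    N.coframe_three hp] at hs
  have h1 := congrArg (fun L => L (N.e₁ p)) hs
  have h2 := congrArg (fun L => L (N.e₂ p)) hs
  simp [N.coframe_zero_e₁ hp, N.coframe_zero_e₂, N.coframe_one_e₁, N.coframe_one_e₂ hp] at h1 h2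
  exact ⟨by linarith, by linarith⟩

/-- Closedness of the third, second and first terms yields in turn `δ₁u = δ₂u`, `δ₁v = -w` and the
equation for `a δ₂v`. -/
theorem isSolution_of_mem (h : lam ∈ W.abelianRelations) :
    N.IsSolution (N.coeff lam 2) (N.coeff lam 3) (N.δ 1 N.e₁ (N.coeff lam 2)) := by
  have hs := N.smooth_coeff h
  have e2 : ∀ p ∈ U, N.δ 1 N.e₂ (N.coeff lam 2) p = N.δ 1 N.e₁ (N.coeff lam 2) p := fun p hp =>
    sub_eq_zero.1 ((N.extD_smul_coframe_two (hs 2) hp).symm.trans (N.extD_coeff_smul_coframe h 2 hp))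
  refine ⟨hs 2, hs 3, N.smooth_δ 1 N.smooth_e₁ (hs 2), fun _ _ => rfl, e2, fun p hp => ?_,
    fun p hp => ?_⟩
  · have h1 := (N.extD_smul_coframe_one (hs 1) hp).symm.trans (N.extD_coeff_smul_coframe h 1 hp)
    rw [N.δ_congr 1 N.e₁ (fun q hq => (N.coeff_zero_one h hq).2) hp,
      N.δ_add 1 N.e₁ (hs 2) (hs 3) hp] at h1
    linarith
  · have h1 := (N.extD_smul_coframe_zero (hs 0) hp).symm.trans (N.extD_coeff_smul_coframe h 0 hp)
    rw [N.δ_congr 1 N.e₂ (fun q hq => (N.coeff_zero_one h hq).1) hp,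
      N.δ_add 1 N.e₂ (hs 2) (N.smooth_a.mul (hs 3)) hp, e2 p hp,
      N.δ_mul (w := 0) (w' := 1) 1 (by norm_num) N.e₂ N.smooth_a (hs 3) hp] at h1
    change -(_ + (N.a₂ p * _ + _)) = 0 at h1
    linarith

/-- The `1`-jet at `p` of an abelian relation. -/
noncomputable def evalJet (hp : p ∈ U) : W.abelianRelations →ₗ[ℝ] ℝ × ℝ × ℝ where
  toFun lam := (N.coeff lam 2 p, N.coeff lam 3 p, N.δ 1 N.e₁ (N.coeff lam 2) p)
  map_add' l l' := by
    have hadd : ∀ i, N.coeff (l + l' : W.abelianRelations) i =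
        fun q => N.coeff l i q + N.coeff l' i q := fun i => by
      ext q
      simp [coeff, add_div]
    rw [hadd, hadd, N.δ_add 1 N.e₁ (N.smooth_coeff l.2 2) (N.smooth_coeff l'.2 2) hp]
    rfl
  map_smul' c l := by
    have hsmul : ∀ i, N.coeff (c • l : W.abelianRelations) i = fun q => c * N.coeff l i q :=
      fun i => by
        ext q
        simp [coeff, mul_div_assoc]
    rw [hsmul, hsmul, N.δ_mul (w := 0) (w' := 1) 1 (by norm_num) N.e₁ contDiffOn_const
      (N.smooth_coeff l.2 2) hp, N.δ_zero_const, zero_mul, zero_add]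
    rfl

/-- A relation with zero jet is a parallel section vanishing at `p`, so `u = v = 0` on `U`; then
`λ₁` and `λ₂` vanish too. Outside `U` all functions are zero by convention. -/
theorem evalJet_injective (hU : IsPreconnected (U : Set Plane)) (hp : p ∈ U) :
    Function.Injective (N.evalJet hp) := by
  rw [injective_iff_map_eq_zero]
  intro l hl
  have hY := (N.isSolution_of_mem l.2).isParallelOn
  have hz : ∀ q ∈ U, N.coeff l 2 q = 0 ∧ N.coeff l 3 q = 0 := fun q hq => by
    have := hY.eq_zero U.isOpen hU N.smooth_conn.continuousOn hp hq hl
    simp only [Prod.mk_eq_zero] at this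
    exact ⟨this.1, this.2.1⟩
  have hz' : ∀ q ∈ U, ∀ i, N.coeff l i q = 0 := fun q hq i => by
    have h01 := N.coeff_zero_one l.2 hq
    rw [(hz q hq).1, (hz q hq).2, mul_zero, add_zero] at h01
    fin_cases i
    exacts [h01.1, h01.2, (hz q hq).1, (hz q hq).2]
  ext i q
  by_cases hq : q ∈ U
  · exact (div_eq_zero_iff.1 (hz' q hq i)).resolve_right (N.scale_ne_zero i q hq)
  · exact l.2.2.1 i q hq

open Classical in
/-- The quadruple of functions attached to a solution `(u, v, w)` of the first order system. -/
noncomputable def relationOf (U : Opens Plane) {W : PlanarWeb 4 U} (N : Normalization W)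
    (u v : Plane → ℝ) (i : Fin 4) (p : Plane) : ℝ :=
  if p ∈ U then ![u p + N.a p * v p, u p + v p, u p, v p] i * N.scale i p else 0

theorem relationOf_of_mem (u v : Plane → ℝ) (i : Fin 4) (hp : p ∈ U) :
    relationOf U N u v i p = ![u p + N.a p * v p, u p + v p, u p, v p] i * N.scale i p :=
  if_pos hp

theorem coeff_relationOf (u v : Plane → ℝ) (i : Fin 4) (hp : p ∈ U) :
    N.coeff (relationOf U N u v) i p = ![u p + N.a p * v p, u p + v p, u p, v p] i := by
  rw [coeff, N.relationOf_of_mem u v i hp, mul_div_cancel_right₀ _ (N.scale_ne_zero i p hp)]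

variable {N} in
theorem IsSolution.relationOf_mem (h : N.IsSolution u v w) :
    relationOf U N u v ∈ W.abelianRelations := by
  have hu := h.smooth_u
  have hv := h.smooth_v
  have ha := N.smooth_a
  have hs : ∀ i, ContDiffOn ℝ ∞ (fun p => ![u p + N.a p * v p, u p + v p, u p, v p] i) U := by
    intro i
    fin_cases i
    exacts [hu.add (ha.mul hv), hu.add hv, hu, hv]
  have hsm : ∀ i, ContDiffOn ℝ ∞ (relationOf U N u v i) U := fun i =>
    ((hs i).mul (N.smooth_scale i)).congr fun p hp => N.relationOf_of_mem u v i hp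
  refine ⟨hsm, fun i p hp => if_neg hp, fun p hp => ?_, fun i p hp => ?_⟩
  · simp only [← N.coeff_smul_coframe _ _ hp, N.coeff_relationOf u v _ hp]
    rw [Fin.sum_univ_four, N.coframe_two hp, N.coframe_three hp]
    simp only [Matrix.cons_val]
    module
  · have hd := W.differentiableAt_smul_form (hsm i) i hp
    refine N.extD_eq_zero hd hp ?_
    rw [extD_congr (β := fun q => ![u q + N.a q * v q, u q + v q, u q, v q] i • N.coframe i q)
      (fun q hq => by
        rw [← N.coeff_smul_coframe _ _ hq, N.coeff_relationOf u v i hq]) hp hd]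
    fin_cases i
    · refine (N.extD_smul_coframe_zero (hu.add (ha.mul hv)) hp).trans ?_
      rw [N.δ_add 1 N.e₂ hu (ha.mul hv) hp, h.δ₂_u p hp,
        N.δ_mul (w := 0) (w' := 1) 1 (by norm_num) N.e₂ ha hv hp, h.δ₂_v p hp]
      change -(_ + (N.a₂ p * _ + _)) = 0
      ring
    · refine (N.extD_smul_coframe_one (hu.add hv) hp).trans ?_
      rw [N.δ_add 1 N.e₁ hu hv hp, h.δ₁_u p hp, h.δ₁_v p hp, add_neg_cancel]
    · refine (N.extD_smul_coframe_two hu hp).trans ?_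
      rw [h.δ₁_u p hp, h.δ₂_u p hp, sub_self]
    · refine (N.extD_smul_coframe_three hv hp).trans ?_
      rw [N.δ_mul (w := 0) (w' := 1) 1 (by norm_num) N.e₂ ha hv hp, h.δ₂_v p hp, h.δ₁_v p hp]
      change N.a₂ p * _ + _ - _ = 0
      ring

variable {N} in
-- Surjectivity of `evalJet` thereby reduces to existence of parallel sections with prescribed
-- value.
theorem IsSolution.evalJet_relationOf (h : N.IsSolution u v w) (hp : p ∈ U) :
    N.evalJet hp ⟨relationOf U N u v, h.relationOf_mem⟩ = (u p, v p, w p) := by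
  refine Prod.ext (N.coeff_relationOf u v 2 hp) (Prod.ext (N.coeff_relationOf u v 3 hp) ?_)
  exact (N.δ_congr 1 N.e₁ (fun q hq => N.coeff_relationOf u v 2 hq) hp).trans (h.δ₁_u p hp)

/-! ### Rank three and flatness -/

theorem finrank_jet : Module.finrank ℝ (ℝ × ℝ × ℝ) = 3 := by simp

/-- A web of rank three on a connected domain satisfies the integrability conditions. -/
theorem formulasAt_of_rank_eq_three (hU : IsPreconnected (U : Set Plane)) (hr : W.rank = 3)
    (hp : p ∈ U) : N.FormulasAt p := by
  have hr' : Module.rank ℝ W.abelianRelations = (3 : ℕ) := by exact_mod_cast hr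
  have : Module.Finite ℝ W.abelianRelations := Module.finite_of_rank_eq_nat hr'
  have hfr : Module.finrank ℝ W.abelianRelations = Module.finrank ℝ (ℝ × ℝ × ℝ) := by
    rw [Module.finrank_eq_of_rank_eq hr', finrank_jet]
  -- Injectivity and equal dimensions: every vector of the fibre at `p` is the value of a parallel
  -- section, and so is killed by the curvature.
  have hsurj : Function.Surjective (N.evalJet hp) :=
    (LinearMap.injective_iff_surjective_of_finrank_eq_finrank hfr).1 (N.evalJet_injective hU hp)
  have key : ∀ y : ℝ × ℝ × ℝ,
      N.obstructionU p * y.1 + N.obstructionV p * y.2.1 + N.obstructionW p * y.2.2 = 0 := fun y => by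
    obtain ⟨l, hl⟩ := hsurj y
    have h := (N.isSolution_of_mem l.2).isParallelOn.connCurvature_apply U.isOpen N.smooth_conn hp
      (N.e₁ p) (N.e₂ p)
    rw [N.connCurvature_conn hp] at h
    rw [← hl]
    exact congrArg (fun z => z.2.2) h
  rw [N.formulasAt_iff_obstructions hp]
  exact ⟨by simpa using key (1, 0, 0), by simpa using key (0, 1, 0), by simpa using key (0, 0, 1)⟩

/-- A web on a simply connected domain which satisfies the integrability conditions has rank
three. -/
theorem rank_eq_three_of_formulasAt [SimplyConnectedSpace U] (h : ∀ p ∈ U, N.FormulasAt p) :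
    W.rank = 3 := by
  obtain ⟨p, hp⟩ := (inferInstance : Nonempty U)
  have hU : IsPreconnected (U : Set Plane) :=
    isPreconnected_iff_preconnectedSpace.2 (inferInstanceAs (PreconnectedSpace U))
  have hflat : ∀ q ∈ U, connCurvature N.conn q (1, 0) (0, 1) = 0 := fun q hq => by
    obtain ⟨hu, hv, hw⟩ := (N.formulasAt_iff_obstructions hq).1 (h q hq)
    have hz : connCurvature N.conn q (N.e₁ q) (N.e₂ q) = 0 := ContinuousLinearMap.ext fun y => by
      rw [N.connCurvature_conn hq, hu, hv, hw]
      simp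
    rw [N.frame_decomp hq (1, 0), N.frame_decomp hq (0, 1), connCurvature_comb, hz, smul_zero]
  have hsurj : Function.Surjective (N.evalJet hp) := fun y => by
    obtain ⟨Y, hY0, hY⟩ := exists_isParallelOn_of_simplyConnected U N.smooth_conn hflat hp y
    exact ⟨_, (IsSolution.evalJet_relationOf (isSolution_of_isParallelOn hY) hp).trans hY0⟩
  rw [PlanarWeb.rank, (LinearEquiv.ofBijective _ ⟨N.evalJet_injective hU hp, hsurj⟩).rank_eq,
    ← Module.finrank_eq_rank, finrank_jet]
  norm_num

/-- The restriction of a normalization to a smaller open set. -/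
def restrict (V : Opens Plane) : Normalization (W.restrict V) where
  scale := N.scale
  smooth_scale i := (N.smooth_scale i).mono fun _ hp => hp.1
  scale_ne_zero i p hp := N.scale_ne_zero i p hp.1
  a := N.a
  normalized₃ p hp := N.normalized₃ p hp.1
  normalized₄ p hp := N.normalized₄ p hp.1

/-- The invariants are built from derivatives at `p` of functions on the whole plane and never refer
to the domain. -/
theorem restrict_formulasAt (V : Opens Plane) : (N.restrict V).FormulasAt p ↔ N.FormulasAt p :=
  Iff.rfl

theorem inf_ball_eq {r : ℝ} (h : Metric.ball p r ⊆ U) :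
    U ⊓ ⟨Metric.ball p r, Metric.isOpen_ball⟩ = ⟨Metric.ball p r, Metric.isOpen_ball⟩ :=
  inf_eq_right.2 h

theorem eventually_ball_subset (hp : p ∈ U) :
    ∀ᶠ r : ℝ in 𝓝[>] 0, 0 < r ∧ Metric.ball p r ⊆ U := by
  obtain ⟨R, hR, hRU⟩ := Metric.isOpen_iff.1 U.isOpen p hp
  filter_upwards [Ioo_mem_nhdsGT hR] with r hr
  exact ⟨hr.1, (Metric.ball_subset_ball hr.2.le).trans hRU⟩

/-- A single small ball suffices, since it is connected and contains `p`. -/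
theorem formulasAt_of_hasRankNear (hp : p ∈ U) (h : W.HasRankNear p 3) : N.FormulasAt p := by
  obtain ⟨r, hr, hr0, hrU⟩ := (h.and (eventually_ball_subset hp)).exists
  refine (N.restrict_formulasAt ⟨Metric.ball p r, Metric.isOpen_ball⟩).1
    ((N.restrict _).formulasAt_of_rank_eq_three ?_ (by exact_mod_cast hr)
      ⟨hp, Metric.mem_ball_self hr0⟩)
  rw [inf_ball_eq hrU]
  exact (convex_ball p r).isPreconnected

/-- Small balls lie in `U` and are convex, hence simply connected, so the global criterion applies
to each of them. -/
theorem hasRankNear_of_formulasAt (h : ∀ p ∈ U, N.FormulasAt p) (hp : p ∈ U) :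
    W.HasRankNear p 3 := by
  filter_upwards [eventually_ball_subset hp] with r hr
  have : SimplyConnectedSpace (U ⊓ ⟨Metric.ball p r, Metric.isOpen_ball⟩ : Opens Plane) := by
    rw [inf_ball_eq hr.2]
    have : ContractibleSpace (Metric.ball p r) :=
      (convex_ball p r).contractibleSpace ⟨p, Metric.mem_ball_self hr.1⟩
    exact (inferInstance : SimplyConnectedSpace (Metric.ball p r))
  exact_mod_cast (N.restrict ⟨Metric.ball p r, Metric.isOpen_ball⟩).rank_eq_three_of_formulasAt
    fun q hq => h q hq.1

end Normalization

theorem mainTheorem3 (U : TopologicalSpace.Opens Plane) (hU : IsConnected (U : Set Plane))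
    (W : PlanarWeb 4 U) (N : Normalization W) :
    ((∀ p ∈ U, W.HasRankNear p 3) ↔ ∀ p ∈ U, N.FormulasAt p) ∧
      (W.rank = 3 → ∀ p ∈ U, N.FormulasAt p) ∧
      (SimplyConnectedSpace U → (W.rank = 3 ↔ ∀ p ∈ U, N.FormulasAt p)) := by
  have hA : W.rank = 3 → ∀ p ∈ U, N.FormulasAt p := fun hr _ hp =>
    N.formulasAt_of_rank_eq_three hU.isPreconnected hr hp
  exact ⟨⟨fun h p hp => N.formulasAt_of_hasRankNear hp (h p hp),
    fun h _ hp => N.hasRankNear_of_formulasAt h hp⟩, hA,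
    fun _ => ⟨hA, fun h => N.rank_eq_three_of_formulasAt h⟩⟩
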